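/- **Properties of the quantum convolution.** Let $n\ge 0$ and consider $n$-qubit systems, with computational basis $|\vec x\rangle$, $\vec x\in\mathbb Z_2^n$. For $(\vec p,\vec q)\in V^n=\mathbb Z_2^n\times\mathbb Z_2^n$ let $w(\vec p,\vec q)=\bigotimes_{a=1}^n i^{-p_aq_a}Z^{p_a}X^{q_a}$ (with $p_a,q_a\in\{0,1\}$) be the Pauli operators, and let $\Xi_\rho(\vec p,\vec q)=\mathrm{Tr}[\rho\, w(-\vec p,-\vec q)]$ be the characteristic function of an operator $\rho$. *Convolution.* For $K=2N+1$ let $U=\bigl(\prod_{j=2}^K \mathrm{CNOT}_{j\to1}\bigr)\bigl(\prod_{i=2}^K \mathrm{CNOT}_{1\to i}\bigr)$ on $K$ qubits, where $\mathrm{CNOT}_{c\to t}$ has control $c$ and target $t$, and let $V=U^{\otimes n}$, the $a$-th copy of $U$ acting on the $a$-th qubits of $K$ systems of $n$ qubits each. Define $$\boxtimes_K\Bigl(\bigotimes_{i=1}^K\rho_i\Bigr)=\mathrm{Tr}_{2,\dots,K}\Bigl[V\Bigl(\bigotimes_{i=1}^K\rho_i\Bigr)V^\dagger\Bigr],\qquad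 \boxtimes_K\rho=\boxtimes_K(\rho^{\otimes K}).$$ *Stabilizer states and Clifford unitaries.* A pure stabilizer state is $|\psi\rangle\langle\psi|$ for a unit vector $\psi$ that is a common eigenvector of an abelian group of $2^n$ Pauli operators (taken modulo phases, i.e. of the pairwise commuting operators $w(v)$, $v\in S$, for a subgroup $S\le V^n$ of order $2^n$); a stabilizer state is a convex combination of pure stabilizer states. A unitary is Clifford if conjugation by it maps every Pauli operator $w(\vec p,\vec q)$ to a Pauli operator up to a phase. *Mean state and magic gap.* The mean state $\mathcal M(\rho)$ is the operator whose characteristic function equals $\Xi_\rho$ where $|\Xi_\rho|=1$ and $0$ elsewhere. The magic gap is $MG(\rho)=1-\max\{|\Xi_\rho(v)|: \Xi_\rho(v)\ne0,\ |\Xi_\rho(v)|\neq1\}$, and $MG(\rho)=0$ if this set is empty. *Majorization and entropy.* $\vec\lambda_\rho$ is the vector of eigenvalues of $\rho$. For probability vectors, $\vec p\prec\vec q$ means that for every $k$ the sum of the $k$ largest components of $\vec p$ is at most that of $\vec q$. For $\alpha\in[0,\infty]$, $S_\alpha(\rho)=\frac1{1-\alpha}\log\mathrm{Tr}[\rho^\alpha]$,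 the power being taken on the support of $\rho$, with $S_1(\rho)=-\mathrm{Tr}[\rho\log\rho]$ and $S_\infty(\rho)=-\log\lambda_{\max}(\rho)$. Finally $\|A\|_2=\sqrt{\mathrm{Tr}[A^\dagger A]}$. Then: 1. For all $n$-qubit states $\rho_1,\rho_2,\rho_3$ and every permutation $\pi$ of $\{1,2,3\}$, $\boxtimes_3(\bigotimes_i\rho_i)=\boxtimes_3(\bigotimes_i\rho_{\pi(i)})$. 2. If $\rho_1,\rho_2,\rho_3$ are stabilizer states, then so is $\boxtimes_3(\bigotimes_i\rho_i)$. 3. For all $n$-qubit states $\rho_1,\rho_2,\rho_3$ and $j=1,2,3$, $\vec\lambda_{\boxtimes_3(\bigotimes_i\rho_i)}\prec\vec\lambda_{\rho_j}$; moreover $S_\alpha\bigl(\boxtimes_3(\bigotimes_i\rho_i)\bigr)\ge\max_iS_\alpha(\rho_i)$ for every $\alpha\in[0,\infty]$. 4. For every pure $n$-qubit state $\psi$, $\boxtimes_3\psi$ is pure if and only if $\psi$ is a stabilizer state. 5. For every $n$-qubit Clifford unitary $U$ there is a Clifford unitary $U_1$ such that $U_1\,\boxtimes_3(\bigotimes_i\rho_i)\,U_1^\dagger=\boxtimes_3(\bigotimes_i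 U\rho_iU^\dagger)$ for all $n$-qubit states $\rho_1,\rho_2,\rho_3$. 6. For all $n$-qubit states $\rho_1,\rho_2,\rho_3$, $\mathcal M\bigl(\boxtimes_3(\bigotimes_i\rho_i)\bigr)=\boxtimes_3\bigl(\bigotimes_i\mathcal M(\rho_i)\bigr)$. 7. For every $n$-qubit state $\rho$, every integer $N\ge0$ and $K=2N+1$, $$\|\boxtimes_K\rho-\mathcal M(\rho^\#)\|_2\le(1-MG(\rho))^{K-1}\,\|\rho-\mathcal M(\rho)\|_2,$$ where $\rho^\#=\rho$ for even $N$ and $\rho^\#=\rho^T$ (transpose in the computational basis) for odd $N$. -/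

import Mathlib

open scoped ENNReal Matrix ComplexOrder

noncomputable section

namespace QubitConv

/-- Computational basis labels of an `n`-qubit system: bit strings in `ℤ₂ⁿ`. -/
abbrev Bits (n : ℕ) : Type := Fin n → ZMod 2

/-- Linear operators on an `n`-qubit system, as matrices in the computational basis. -/
abbrev Op (n : ℕ) : Type := Matrix (Bits n) (Bits n) ℂ

/-- The phase space `Vⁿ = ℤ₂ⁿ × ℤ₂ⁿ`; an element is a pair `(p, q)`. -/
abbrev PhaseSpace (n : ℕ) : Type := Bits n × Bits n

/-! ### States, Pauli operators, characteristic functions -/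

/-- Quantum states (density operators). -/
def IsState {n : ℕ} (ρ : Op n) : Prop := ρ.PosSemidef ∧ ρ.trace = 1

/-- Pure states: the projections `|ψ⟩⟨ψ|` onto unit vectors. -/
def IsPure {n : ℕ} (ρ : Op n) : Prop :=
  ∃ ψ : Bits n → ℂ, star ψ ⬝ᵥ ψ = 1 ∧ ρ = Matrix.vecMulVec ψ (star ψ)

/-- `X |k⟩ = |k + 1⟩`. -/
def pauliX : Matrix (ZMod 2) (ZMod 2) ℂ := Matrix.of fun j k => if j = k + 1 then 1 else 0

/-- `Z |k⟩ = (-1)ᵏ |k⟩`. -/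
def pauliZ : Matrix (ZMod 2) (ZMod 2) ℂ := Matrix.diagonal fun k => (-1) ^ k.val

/-- The one-qubit Pauli operator `w(p, q) = i^{-pq} Z^p X^q`, for `p, q ∈ {0, 1}`. -/
def pauliOne (p q : ZMod 2) : Matrix (ZMod 2) (ZMod 2) ℂ :=
  (Complex.I⁻¹ ^ (p.val * q.val)) • (pauliZ ^ p.val * pauliX ^ q.val)

/-- The `n`-qubit Pauli operator `w(p, q) = w(p₁, q₁) ⊗ ⋯ ⊗ w(pₙ, qₙ)`. -/
def pauli {n : ℕ} (v : PhaseSpace n) : Op n :=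
  Matrix.of fun x y => ∏ a, pauliOne (v.1 a) (v.2 a) (x a) (y a)

/-- The characteristic function `Ξ_ρ(p, q) = Tr[ρ w(-p, -q)]`. -/
def charFn {n : ℕ} (ρ : Op n) (v : PhaseSpace n) : ℂ := (ρ * pauli (-v)).trace

/-! ### Stabilizer states and Clifford unitaries -/

/-- `ρ = |ψ⟩⟨ψ|` for a unit vector `ψ` that is a common eigenvector of an abelian group of
`2ⁿ` Pauli operators. The group is taken modulo phases, that is, as a subgroup `S` of the phase
space `ℤ₂ⁿ × ℤ₂ⁿ`. -/
def IsPureStabilizer {n : ℕ} (ρ : Op n) : Prop :=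
  ∃ (S : AddSubgroup (PhaseSpace n)) (ψ : Bits n → ℂ),
    Nat.card S = 2 ^ n ∧
    (∀ a ∈ S, ∀ b ∈ S, pauli a * pauli b = pauli b * pauli a) ∧
    star ψ ⬝ᵥ ψ = 1 ∧
    (∀ a ∈ S, ∃ c : ℂ, pauli a *ᵥ ψ = c • ψ) ∧
    ρ = Matrix.vecMulVec ψ (star ψ)

/-- Stabilizer states: convex combinations of pure stabilizer states. -/
def IsStabilizer {n : ℕ} (ρ : Op n) : Prop :=
  ρ ∈ convexHull ℝ {σ : Op n | IsPureStabilizer σ}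

/-- Clifford unitaries: conjugation maps each Pauli operator to a Pauli operator up to a phase. -/
def IsClifford {n : ℕ} (U : Op n) : Prop :=
  U ∈ Matrix.unitaryGroup (Bits n) ℂ ∧
    ∀ v : PhaseSpace n, ∃ (v' : PhaseSpace n) (c : ℂ), ‖c‖ = 1 ∧ U * pauli v * Uᴴ = c • pauli v'

/-! ### The convolution of `K = 2N + 1` systems of `n` qubits -/

/-- The gate `CNOT_{c → t}` (control `c`, target `t`) on `K` qubits: it sends the basis vector
`|x⟩` to the one with `x_t` replaced by `x_t + x_c`. -/
def cnot {K : ℕ} (c t : Fin K) : Matrix (Fin K → ZMod 2) (Fin K → ZMod 2) ℂ :=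
  Matrix.of fun y x => if y = Function.update x t (x t + x c) then 1 else 0

/-- The `K`-qubit unitary `U = (∏_{j ≠ 1} CNOT_{j → 1}) (∏_{i ≠ 1} CNOT_{1 → i})` for
`K = 2N + 1`; the first qubit has index `0` here. -/
def keyU (N : ℕ) : Matrix (Fin (2 * N + 1) → ZMod 2) (Fin (2 * N + 1) → ZMod 2) ℂ :=
  ((List.finRange (2 * N)).map fun j => cnot j.succ 0).prod *
    ((List.finRange (2 * N)).map fun i => cnot 0 i.succ).prod

/-- Operators on `K` systems of `n` qubits each. The basis label `x` assigns to the system `k`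
the bit string `x k`. -/
abbrev MultiOp (K n : ℕ) : Type := Matrix (Fin K → Bits n) (Fin K → Bits n) ℂ

/-- The key unitary `V = U^{⊗ n}`, where the `a`-th copy of `U` acts on the `a`-th qubits of the
`K` systems. -/
def keyV (N n : ℕ) : MultiOp (2 * N + 1) n :=
  Matrix.of fun y x => ∏ a : Fin n, keyU N (fun k => y k a) (fun k => x k a)

/-- The tensor product `ρ₁ ⊗ ⋯ ⊗ ρ_K`. -/
def tensor {K n : ℕ} (ρ : Fin K → Op n) : MultiOp K n :=
  Matrix.of fun x y => ∏ k, ρ k (x k) (y k)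

/-- The partial trace over all systems but the first. -/
def partialTrace {m n : ℕ} (A : MultiOp (m + 1) n) : Op n :=
  Matrix.of fun x y =>
    ∑ z : Fin m → Bits n, A (Fin.cons (α := fun _ => Bits n) x z)
      (Fin.cons (α := fun _ => Bits n) y z)

/-- The convolution `⊠_K(ρ₁, …, ρ_K) = Tr_{2, …, K}[V (ρ₁ ⊗ ⋯ ⊗ ρ_K) V†]` with `K = 2N + 1`. -/
def convolution {n : ℕ} (N : ℕ) (ρ : Fin (2 * N + 1) → Op n) : Op n :=
  partialTrace (keyV N n * tensor ρ * (keyV N n)ᴴ)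

/-- The three-fold convolution `⊠₃`. -/
def conv3 {n : ℕ} (ρ : Fin 3 → Op n) : Op n := convolution 1 ρ

/-! ### Mean state, magic gap, Hilbert-Schmidt norm -/

open Classical in
/-- The characteristic function of the mean state: `Ξ_ρ` cut off to where it has modulus `1`. -/
def meanCharFn {n : ℕ} (ρ : Op n) (v : PhaseSpace n) : ℂ :=
  if ‖charFn ρ v‖ = 1 then charFn ρ v else 0

/-- The mean state `M(ρ)`, the operator with characteristic function `meanCharFn ρ`, given by
Fourier inversion `M(ρ) = 2⁻ⁿ ∑ Ξ_{M(ρ)}(p, q) w(p, q)`. -/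
def meanState {n : ℕ} (ρ : Op n) : Op n :=
  ((2 : ℂ) ^ n)⁻¹ • ∑ v : PhaseSpace n, meanCharFn ρ v • pauli v

open Classical in
/-- The points of the support of `Ξ_ρ` at which `Ξ_ρ` does not have modulus `1`. -/
def gapSet {n : ℕ} (ρ : Op n) : Finset (PhaseSpace n) :=
  Finset.univ.filter fun v => charFn ρ v ≠ 0 ∧ ‖charFn ρ v‖ ≠ 1

open Classical in
/-- The magic gap: `1 - max |Ξ_ρ|` over `gapSet ρ`, and `0` when that set is empty. -/
def magicGap {n : ℕ} (ρ : Op n) : ℝ :=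
  if h : (gapSet ρ).Nonempty then 1 - (gapSet ρ).sup' h (fun v => ‖charFn ρ v‖) else 0

/-- The Hilbert-Schmidt norm `‖A‖₂ = √(Tr[A† A])`. -/
def normTwo {n : ℕ} (A : Op n) : ℝ := √((Aᴴ * A).trace.re)

/-! ### Majorization and Rényi entropy -/

/-- The sum of the `k` largest components of `p`, counted with multiplicity. -/
def sumLargest {ι : Type*} [Fintype ι] (p : ι → ℝ) (k : ℕ) : ℝ :=
  (((Finset.univ.val.map p).sort (· ≥ ·)).take k).sum

/-- `p ≺ q`: the probability vector `p` is majorized by the probability vector `q`. -/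
def Majorized {ι : Type*} [Fintype ι] (p q : ι → ℝ) : Prop :=
  p ∈ stdSimplex ℝ ι ∧ q ∈ stdSimplex ℝ ι ∧ ∀ k : ℕ, sumLargest p k ≤ sumLargest q k

open Classical in
/-- The quantum Rényi entropy `S_α(ρ) = (1 - α)⁻¹ log Tr[ρ^α]` for `α ∈ [0, ∞]`, in terms of the
eigenvalues of `ρ`. The power is taken on the support of `ρ` (so `S₀` is the logarithm of the
rank), and `α = 1`, `α = ∞` are the limiting cases: the von Neumann entropy `-Tr[ρ log ρ]` and
the min-entropy, minus the logarithm of the largest eigenvalue. -/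
def renyiEntropy {n : ℕ} (α : ℝ≥0∞) (ρ : Op n) (hρ : ρ.IsHermitian) : ℝ :=
  if α = ∞ then -Real.log (⨆ i, hρ.eigenvalues i)
  else if α = 1 then -∑ i, hρ.eigenvalues i * Real.log (hρ.eigenvalues i)
  else (1 - α.toReal)⁻¹ *
    Real.log (∑ i with hρ.eigenvalues i ≠ 0, hρ.eigenvalues i ^ α.toReal)

/-! ### The convolution of states is Hermitian, so that it has a vector of real eigenvalues -/

theorem IsState.isHermitian {n : ℕ} {ρ : Op n} (h : IsState ρ) : ρ.IsHermitian := h.1.1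

theorem tensor_isHermitian {K n : ℕ} {ρ : Fin K → Op n} (h : ∀ i, IsState (ρ i)) :
    (tensor ρ).IsHermitian := by
  ext x y
  simp only [Matrix.conjTranspose_apply, tensor, Matrix.of_apply, star_prod]
  exact Finset.prod_congr rfl fun k _ => (h k).isHermitian.apply _ _

theorem conv3_isHermitian {n : ℕ} {ρ : Fin 3 → Op n} (h : ∀ i, IsState (ρ i)) :
    (conv3 ρ).IsHermitian := by
  have hA : (keyV 1 n * tensor ρ * (keyV 1 n)ᴴ).IsHermitian :=
    Matrix.isHermitian_mul_mul_conjTranspose _ (tensor_isHermitian h)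
  ext x y
  simp only [Matrix.conjTranspose_apply, conv3, convolution, partialTrace, Matrix.of_apply,
    star_sum]
  exact Finset.sum_congr rfl fun z _ => hA.apply _ _

end QubitConv

end

open QubitConv

/-!
The whole theorem is read off from the characteristic function of the convolution. The key unitary
permutes the computational basis by `(x₁, …, x_K) ↦ (∑ xₖ, x₂ + x₁, …, x_K + x₁)` (`keyV_eq`), and
since `K = 2N + 1` is odd, the partial trace keeps exactly the matrix entries whose row and column
labels differ by the same shift in all `K` systems. This gives (`charFn_convolution`)
`Ξ_{⊠_K(ρ₁, …, ρ_K)}(p, q) = (-1)^{N p·q} ∏ₖ Ξ_{ρₖ}(p, q)`,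
where the sign comes from the phases `i^{-p·q}` and is the one that transposition produces. As
operators are determined by their characteristic functions (`charFn_injective`), the symmetry, the
formula for mean states and the Clifford covariance are comparisons of such functions; for a
Clifford unitary `U` the unitary `U₁` is the entrywise complex conjugate of `U`, because the
convolution contains a transposition. The central limit estimate is Parseval's identity
(`normTwo_eq`) together with a pointwise bound: `Ξ` is unchanged where `|Ξ| = 1`, and elsewhere
`|Ξ|^K ≤ (1 - MG)^{K-1} |Ξ|`.

Stability and majorization rest on one more observation (`exists_conv3_eq_sum_pauli_conj`): for
fixed `ρ₂, ρ₃` the convolution multiplies `Ξ_{ρ₁}` by `Ξ_{ρ₂ᵀ} Ξ_{ρ₃}`, whose Fourier coefficients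
are the nonnegative numbers `2⁻ⁿ Tr[ρ₂ᵀ w(u) ρ₃ w(u)†]`. Hence it is a mixture of the conjugations
`ρ₁ ↦ w(u) ρ₁ w(u)†`. These preserve pure stabilizer states, and the eigenvalue vector of a mixture
of unitary conjugates of `ρ₁` is a doubly stochastic image of that of `ρ₁`, so that Birkhoff's
theorem yields the majorization and Jensen's inequality the entropy bounds.

For a pure state `ψ`, Parseval's identity reads `∑ |Ξ_ψ|² = 2ⁿ`, and purity of `⊠₃ ψ` forces
`∑ |Ξ_ψ|⁶ = 2ⁿ`. Both hold only if `|Ξ_ψ|` takes the values `0` and `1` alone, and then the points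
of modulus `1` form the stabilizer group. Conversely a pure state in the convex hull of the pure
stabilizer states is one of them, since pure states are extreme, and its convolution is its
transpose.
-/

noncomputable section

namespace QubitConv

/-! ### The sign character of `ℤ₂ⁿ` and the entries of the Pauli operators -/

/-- The sign character `a ↦ (-1)ᵃ` of `ℤ₂`. -/
def sgn (a : ZMod 2) : ℂ := (-1) ^ a.val

/-- The pairing `(p, x) ↦ (-1)^{p · x}` of `ℤ₂ⁿ` with itself. -/
def chi {n : ℕ} (p x : Bits n) : ℂ := ∏ a, sgn (p a * x a)

/-- The phase `i^{-p · q}` of the Pauli operator `w(p, q)`, the exponent being an integer. -/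
def phase {n : ℕ} (v : PhaseSpace n) : ℂ := ∏ a, Complex.I⁻¹ ^ ((v.1 a).val * (v.2 a).val)

theorem zmod_two_cases (a : ZMod 2) : a = 0 ∨ a = 1 := by
  revert a; decide

theorem sgn_zero : sgn 0 = 1 := by simp [sgn]

theorem sgn_one : sgn 1 = -1 := by simp [sgn, ZMod.val_one]

theorem zmod_two_one_add_one : (1 : ZMod 2) + 1 = 0 := rfl

theorem sgn_add (a b : ZMod 2) : sgn (a + b) = sgn a * sgn b := by
  rcases zmod_two_cases a with rfl | rfl <;> rcases zmod_two_cases b with rfl | rfl <;>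
    simp [sgn_zero, sgn_one, zmod_two_one_add_one]

theorem sgn_mul_self (a : ZMod 2) : sgn a * sgn a = 1 := by
  rcases zmod_two_cases a with rfl | rfl <;> simp [sgn_zero, sgn_one]

theorem star_sgn (a : ZMod 2) : star (sgn a) = sgn a := by
  simp [sgn]

theorem bits_add_self {n : ℕ} (x : Bits n) : x + x = 0 := by
  ext a; exact CharTwo.add_self_eq_zero _

theorem bits_neg {n : ℕ} (x : Bits n) : -x = x := by
  ext a; exact CharTwo.neg_eq _

theorem phaseSpace_neg {n : ℕ} (v : PhaseSpace n) : -v = v :=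
  Prod.ext (bits_neg _) (bits_neg _)

theorem bits_add_add {n : ℕ} (x y : Bits n) : x + y + y = x := by
  rw [add_assoc, bits_add_self, add_zero]

theorem bits_eq_add_iff {n : ℕ} {x y z : Bits n} : x = y + z ↔ y = x + z := by
  constructor <;> rintro rfl <;> rw [bits_add_add]

theorem chi_add_right {n : ℕ} (p x y : Bits n) : chi p (x + y) = chi p x * chi p y := by
  simp [chi, mul_add, sgn_add, Finset.prod_mul_distrib]

theorem chi_add_left {n : ℕ} (p q x : Bits n) : chi (p + q) x = chi p x * chi q x := by
  simp [chi, add_mul, sgn_add, Finset.prod_mul_distrib]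

theorem chi_zero_right {n : ℕ} (p : Bits n) : chi p 0 = 1 := by
  simp [chi, sgn_zero]

theorem chi_zero_left {n : ℕ} (p : Bits n) : chi 0 p = 1 := by
  simp [chi, sgn_zero]

theorem chi_comm {n : ℕ} (p q : Bits n) : chi p q = chi q p := by
  simp [chi, mul_comm]

theorem chi_mul_self {n : ℕ} (p x : Bits n) : chi p x * chi p x = 1 := by
  simp [chi, ← Finset.prod_mul_distrib, sgn_mul_self]

theorem star_chi {n : ℕ} (p x : Bits n) : star (chi p x) = chi p x := by
  simp only [chi, star_prod, star_sgn]

theorem norm_chi {n : ℕ} (p x : Bits n) : ‖chi p x‖ = 1 := by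
  have h := congrArg norm (chi_mul_self p x)
  rw [norm_mul, norm_one] at h
  nlinarith [norm_nonneg (chi p x)]

theorem chi_sum_right {n : ℕ} {ι : Type*} (s : Finset ι) (p : Bits n) (x : ι → Bits n) :
    chi p (∑ i ∈ s, x i) = ∏ i ∈ s, chi p (x i) := by
  classical
  induction s using Finset.induction_on with
  | empty => simp [chi_zero_right]
  | insert a s ha ih => rw [Finset.sum_insert ha, Finset.prod_insert ha, chi_add_right, ih]

/-- Orthogonality of the characters of `ℤ₂ⁿ`. -/
theorem sum_chi {n : ℕ} (x : Bits n) : ∑ p, chi p x = if x = 0 then (2 : ℂ) ^ n else 0 := by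
  have h1 : ∀ c : ZMod 2, ∑ b : ZMod 2, sgn (b * c) = if c = 0 then 2 else 0 := by
    intro c
    rw [show (Finset.univ : Finset (ZMod 2)) = {0, 1} from rfl]
    rcases zmod_two_cases c with rfl | rfl <;> simp [sgn_zero, sgn_one]
  have h := Finset.prod_univ_sum (fun _ : Fin n => (Finset.univ : Finset (ZMod 2)))
    (fun a b => sgn (b * x a))
  simp only [Fintype.piFinset_univ] at h
  simp only [chi]
  rw [← h]
  simp only [h1]
  split_ifs with hx
  · subst hx; simp
  · obtain ⟨a, ha⟩ := Function.ne_iff.1 hx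
    exact Finset.prod_eq_zero (Finset.mem_univ a) (by simpa using ha)

theorem phase_mul_self {n : ℕ} (v : PhaseSpace n) : phase v * phase v = chi v.1 v.2 := by
  simp only [phase, chi, ← Finset.prod_mul_distrib]
  refine Finset.prod_congr rfl fun a _ => ?_
  generalize v.1 a = p; generalize v.2 a = q
  rcases zmod_two_cases p with rfl | rfl <;> rcases zmod_two_cases q with rfl | rfl <;>
    simp [sgn_zero, sgn_one, ZMod.val_one]

theorem star_phase {n : ℕ} (v : PhaseSpace n) : star (phase v) = chi v.1 v.2 * phase v := by
  simp only [phase, chi, ← Finset.prod_mul_distrib, star_prod]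
  refine Finset.prod_congr rfl fun a _ => ?_
  generalize v.1 a = p; generalize v.2 a = q
  rcases zmod_two_cases p with rfl | rfl <;> rcases zmod_two_cases q with rfl | rfl <;>
    simp [sgn_zero, sgn_one, ZMod.val_one]

theorem norm_phase {n : ℕ} (v : PhaseSpace n) : ‖phase v‖ = 1 := by
  have h := congrArg norm (phase_mul_self v)
  rw [norm_mul, norm_chi] at h
  nlinarith [norm_nonneg (phase v)]

theorem phase_ne_zero {n : ℕ} (v : PhaseSpace n) : phase v ≠ 0 := by
  rw [← norm_ne_zero_iff, norm_phase]; exact one_ne_zero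

theorem phase_zero {n : ℕ} : phase (0 : PhaseSpace n) = 1 := by
  simp [phase]

theorem pauliOne_apply (p q x y : ZMod 2) :
    pauliOne p q x y =
      if x = y + q then Complex.I⁻¹ ^ (p.val * q.val) * sgn (p * x) else 0 := by
  rcases zmod_two_cases p with rfl | rfl <;> rcases zmod_two_cases q with rfl | rfl <;>
    rcases zmod_two_cases x with rfl | rfl <;> rcases zmod_two_cases y with rfl | rfl <;>
    simp [pauliOne, pauliX, pauliZ, sgn_zero, sgn_one, ZMod.val_one, zmod_two_one_add_one]

/-- The entries of the Pauli operators. -/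
theorem pauli_apply {n : ℕ} (v : PhaseSpace n) (x y : Bits n) :
    pauli v x y = if x = y + v.2 then phase v * chi v.1 x else 0 := by
  simp only [pauli, Matrix.of_apply, pauliOne_apply]
  split_ifs with h
  · rw [phase, chi, ← Finset.prod_mul_distrib]
    refine Finset.prod_congr rfl fun a _ => ?_
    rw [if_pos (by rw [h]; rfl)]
  · obtain ⟨a, ha⟩ := Function.ne_iff.1 h
    exact Finset.prod_eq_zero (Finset.mem_univ a) (if_neg ha)

/-! ### The algebra of Pauli operators -/

theorem pauli_conjTranspose {n : ℕ} (v : PhaseSpace n) : (pauli v)ᴴ = pauli v := by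
  ext x y
  rw [Matrix.conjTranspose_apply, pauli_apply, pauli_apply]
  by_cases h : x = y + v.2
  · rw [if_pos h, if_pos (bits_eq_add_iff.1 h), star_mul', star_chi, star_phase, h, chi_add_right]
    ring
  · rw [if_neg h, if_neg (fun h' => h (bits_eq_add_iff.1 h')), star_zero]

theorem pauli_transpose {n : ℕ} (v : PhaseSpace n) :
    (pauli v)ᵀ = chi v.1 v.2 • pauli v := by
  ext x y
  rw [Matrix.transpose_apply, Matrix.smul_apply, pauli_apply, pauli_apply, smul_eq_mul]
  by_cases h : x = y + v.2
  · rw [if_pos h, if_pos (bits_eq_add_iff.1 h), h, chi_add_right]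
    linear_combination -(phase v * chi v.1 y) * chi_mul_self v.1 v.2
  · rw [if_neg h, if_neg (fun h' => h (bits_eq_add_iff.1 h')), mul_zero]

theorem pauli_zero {n : ℕ} : pauli (0 : PhaseSpace n) = 1 := by
  ext x y
  simp [pauli_apply, phase_zero, chi_zero_left, Matrix.one_apply]

/-- The composition law: `w(a) w(b)` is `w(a + b)` up to a phase. -/
theorem pauli_mul {n : ℕ} (a b : PhaseSpace n) :
    pauli a * pauli b =
      (phase a * phase b * (phase (a + b))⁻¹ * chi b.1 a.2) • pauli (a + b) := by
  ext x y
  rw [Matrix.mul_apply, Matrix.smul_apply, pauli_apply, smul_eq_mul]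
  simp only [pauli_apply, mul_ite, mul_zero]
  rw [Finset.sum_ite_eq' Finset.univ (y + b.2)]
  simp only [Finset.mem_univ, if_true, Prod.snd_add, Prod.fst_add]
  by_cases h : x = y + (a.2 + b.2)
  · rw [if_pos h, if_pos (by rw [h]; abel)]
    have e : y + b.2 = x + a.2 := by
      rw [h, add_comm a.2, ← add_assoc, bits_add_add]
    rw [e, chi_add_right, chi_add_left]
    have := phase_ne_zero (a + b)
    field_simp
  · rw [if_neg h, if_neg (fun h' => h (by rw [h']; abel)), zero_mul]

theorem pauli_mul_self {n : ℕ} (v : PhaseSpace n) : pauli v * pauli v = 1 := by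
  rw [pauli_mul, show v + v = 0 from Prod.ext (bits_add_self _) (bits_add_self _), pauli_zero,
    phase_zero, phase_mul_self, inv_one, mul_one, chi_mul_self, one_smul]

/-- The commutation sign `(-1)^{⟨a, b⟩}` of `w(a)` and `w(b)`, with `⟨·, ·⟩` the symplectic form. -/
def comSign {n : ℕ} (a b : PhaseSpace n) : ℂ := chi a.1 b.2 * chi b.1 a.2

theorem comSign_add_right {n : ℕ} (a b c : PhaseSpace n) :
    comSign a (b + c) = comSign a b * comSign a c := by
  simp only [comSign, Prod.fst_add, Prod.snd_add, chi_add_left, chi_add_right]; ring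

theorem comSign_mul_self {n : ℕ} (a b : PhaseSpace n) : comSign a b * comSign a b = 1 := by
  rw [comSign]
  linear_combination chi b.1 a.2 * chi b.1 a.2 * chi_mul_self a.1 b.2 + chi_mul_self b.1 a.2

theorem star_comSign {n : ℕ} (a b : PhaseSpace n) : star (comSign a b) = comSign a b := by
  rw [comSign, star_mul', star_chi, star_chi]

theorem pauli_mul_comm {n : ℕ} (a b : PhaseSpace n) :
    pauli a * pauli b = comSign a b • (pauli b * pauli a) := by
  rw [pauli_mul, pauli_mul, smul_smul, comSign, add_comm b a]
  congr 1
  linear_combination -(phase a * phase b * (phase (a + b))⁻¹ * chi b.1 a.2) * chi_mul_self a.1 b.2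

/-- Conjugation by a Pauli operator multiplies Pauli operators by the commutation sign. -/
theorem pauli_conj {n : ℕ} (u v : PhaseSpace n) :
    pauli u * pauli v * pauli u = comSign u v • pauli v := by
  rw [pauli_mul_comm, Matrix.smul_mul, Matrix.mul_assoc, pauli_mul_self, Matrix.mul_one]

/-- The symplectic form is nondegenerate. -/
theorem sum_comSign {n : ℕ} (v : PhaseSpace n) :
    ∑ u, comSign u v = if v = 0 then (4 : ℂ) ^ n else 0 := by
  simp only [comSign, Fintype.sum_prod_type, ← Finset.mul_sum, ← Finset.sum_mul]
  simp only [chi_comm v.1, sum_chi]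
  by_cases h1 : v.1 = 0 <;> by_cases h2 : v.2 = 0 <;> simp [h1, h2, Prod.ext_iff, ← mul_pow]
  norm_num

/-- Completeness of the Pauli operators. -/
theorem sum_pauli_mul_pauli {n : ℕ} (x y z t : Bits n) :
    ∑ v, pauli v x y * star (pauli v z t) =
      if x = z ∧ y = t then (2 : ℂ) ^ n else 0 := by
  have key : ∀ v : PhaseSpace n, pauli v x y * star (pauli v z t) =
      if v.2 = x + y then (if x + y = z + t then chi v.1 (x + z) else 0) else 0 := by
    intro v
    have e : ∀ a b : Bits n, a = b + v.2 ↔ v.2 = a + b := by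
      intro a b
      rw [add_comm b, bits_eq_add_iff]
    rw [pauli_apply, pauli_apply]
    simp only [e]
    by_cases h1 : v.2 = x + y
    · by_cases h2 : x + y = z + t
      · rw [if_pos h1, if_pos (h1.trans h2), if_pos h1, if_pos h2, star_mul', star_phase,
          star_chi, chi_add_right]
        linear_combination (chi v.1 v.2 * chi v.1 x * chi v.1 z) * phase_mul_self v +
          (chi v.1 x * chi v.1 z) * chi_mul_self v.1 v.2
      · rw [if_pos h1, if_neg (fun h => h2 (h1.symm.trans h)), if_pos h1, if_neg h2, star_zero,
          mul_zero]
    · rw [if_neg h1, if_neg h1, zero_mul]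
  simp only [key, Fintype.sum_prod_type]
  simp only [Finset.sum_ite_eq', Finset.mem_univ, if_true]
  by_cases h2 : x + y = z + t
  · simp only [if_pos h2, sum_chi]
    by_cases h : x = z
    · subst h
      have : y = t := add_left_cancel h2
      simp [this, bits_add_self]
    · have : x + z ≠ 0 := fun h' => h (by
        rw [bits_eq_add_iff.1 h'.symm, zero_add])
      simp [this, h]
  · simp only [if_neg h2, Finset.sum_const_zero]
    rw [if_neg]
    rintro ⟨rfl, rfl⟩
    exact h2 rfl

/-! ### Characteristic functions: Parseval, inversion, bounds -/

theorem charFn_eq {n : ℕ} (A : Op n) (v : PhaseSpace n) :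
    charFn A v = (A * pauli v).trace := by
  rw [charFn, phaseSpace_neg]

theorem charFn_eq_sum {n : ℕ} (A : Op n) (v : PhaseSpace n) :
    charFn A v = ∑ x, ∑ y, A x y * pauli v y x := by
  rw [charFn_eq, Matrix.trace]
  simp only [Matrix.diag_apply, Matrix.mul_apply]

theorem charFn_sub {n : ℕ} (A B : Op n) (v : PhaseSpace n) :
    charFn (A - B) v = charFn A v - charFn B v := by
  simp only [charFn_eq, Matrix.sub_mul, Matrix.trace_sub]

theorem charFn_smul {n : ℕ} (c : ℂ) (A : Op n) (v : PhaseSpace n) :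
    charFn (c • A) v = c * charFn A v := by
  simp only [charFn_eq, Matrix.smul_mul, Matrix.trace_smul, smul_eq_mul]

theorem charFn_sum {n : ℕ} {ι : Type*} (s : Finset ι) (A : ι → Op n) (v : PhaseSpace n) :
    charFn (∑ i ∈ s, A i) v = ∑ i ∈ s, charFn (A i) v := by
  simp only [charFn_eq, Matrix.sum_mul, Matrix.trace_sum]

theorem charFn_zero {n : ℕ} (A : Op n) : charFn A 0 = A.trace := by
  rw [charFn_eq, pauli_zero, mul_one]

/-- Parseval's identity for the Hilbert-Schmidt inner product. -/
theorem parseval {n : ℕ} (A B : Op n) :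
    ∑ v, charFn A v * star (charFn B v) = (2 : ℂ) ^ n * (A * Bᴴ).trace := by
  have h1 : ∀ v, charFn A v * star (charFn B v) = ∑ x, ∑ y, ∑ z, ∑ t,
      A x y * star (B z t) * (pauli v y x * star (pauli v t z)) := by
    intro v
    simp only [charFn_eq_sum, star_sum, star_mul', Finset.sum_mul]
    simp only [Finset.mul_sum]
    refine Finset.sum_congr rfl fun x _ => Finset.sum_congr rfl fun y _ =>
      Finset.sum_congr rfl fun z _ => Finset.sum_congr rfl fun t _ => by ring
  simp only [h1]
  rw [Finset.sum_comm]
  have h2 : ∀ x : Bits n, ∑ v : PhaseSpace n, ∑ y, ∑ z, ∑ t,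
      A x y * star (B z t) * (pauli v y x * star (pauli v t z)) =
      ∑ y, A x y * star (B x y) * 2 ^ n := by
    intro x
    rw [Finset.sum_comm]
    refine Finset.sum_congr rfl fun y _ => ?_
    rw [Finset.sum_comm, Finset.sum_eq_single x]
    · rw [Finset.sum_comm, Finset.sum_eq_single y]
      · rw [← Finset.mul_sum, sum_pauli_mul_pauli, if_pos ⟨rfl, rfl⟩]
      · intro t _ ht
        rw [← Finset.mul_sum, sum_pauli_mul_pauli, if_neg (fun h => ht h.1.symm), mul_zero]
      · intro h; exact absurd (Finset.mem_univ _) h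
    · intro z _ hz
      rw [Finset.sum_comm]
      refine Finset.sum_eq_zero fun t _ => ?_
      rw [← Finset.mul_sum, sum_pauli_mul_pauli, if_neg (fun h => hz h.2.symm), mul_zero]
    · intro h; exact absurd (Finset.mem_univ _) h
  simp only [h2, Matrix.trace, Matrix.diag_apply, Matrix.mul_apply, Matrix.conjTranspose_apply,
    Finset.mul_sum]
  exact Finset.sum_congr rfl fun x _ => Finset.sum_congr rfl fun y _ => by ring

theorem sum_norm_charFn_sq {n : ℕ} (A : Op n) :
    ∑ v, ‖charFn A v‖ ^ 2 = 2 ^ n * (Aᴴ * A).trace.re := by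
  have h := congrArg Complex.re (parseval A A)
  rw [Matrix.trace_mul_comm] at h
  have e : ∀ z : ℂ, z * star z = ((‖z‖ ^ 2 : ℝ) : ℂ) := by
    intro z
    rw [Complex.star_def, Complex.mul_conj, Complex.normSq_eq_norm_sq]
  simp only [e] at h
  rw [← Complex.ofReal_sum, Complex.ofReal_re] at h
  rw [h, show (2 : ℂ) ^ n = ((2 ^ n : ℝ) : ℂ) by push_cast; rfl, Complex.re_ofReal_mul]

theorem normTwo_eq {n : ℕ} (A : Op n) :
    normTwo A = √((2 ^ n)⁻¹ * ∑ v, ‖charFn A v‖ ^ 2) := by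
  rw [normTwo, sum_norm_charFn_sq, inv_mul_cancel_left₀ (by positivity)]

/-- An operator is determined by its characteristic function. -/
theorem charFn_injective {n : ℕ} {A B : Op n} (h : ∀ v, charFn A v = charFn B v) : A = B := by
  have h0 := parseval (A - B) (A - B)
  simp only [charFn_sub, h, sub_self, zero_mul, Finset.sum_const_zero] at h0
  have h1 : ((A - B) * (A - B)ᴴ).trace = 0 :=
    (mul_eq_zero.1 h0.symm).resolve_left (by positivity)
  exact sub_eq_zero.1 (Matrix.trace_mul_conjTranspose_self_eq_zero_iff.1 h1)

theorem trace_pauli {n : ℕ} (v : PhaseSpace n) :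
    (pauli v).trace = if v = 0 then (2 : ℂ) ^ n else 0 := by
  split_ifs with h
  · rw [h, pauli_zero, Matrix.trace_one]
    simp [Bits]
  · -- conjugation by each `w(u)` preserves the trace, and on average it kills `w(v)`
    have h1 : ∀ u : PhaseSpace n, (pauli v).trace = comSign u v * (pauli v).trace := by
      intro u
      rw [← smul_eq_mul, ← Matrix.trace_smul, ← pauli_conj, Matrix.trace_mul_comm,
        ← Matrix.mul_assoc, pauli_mul_self, Matrix.one_mul]
    have h2 : ∑ u : PhaseSpace n, (pauli v).trace = 0 := by
      rw [Finset.sum_congr rfl fun u _ => h1 u, ← Finset.sum_mul, sum_comSign, if_neg h, zero_mul]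
    rw [Finset.sum_const, nsmul_eq_mul] at h2
    refine (mul_eq_zero.1 h2).resolve_left ?_
    simp

theorem phaseSpace_add_eq_zero {n : ℕ} {a b : PhaseSpace n} : a + b = 0 ↔ a = b := by
  rw [← sub_eq_zero (a := a) (b := b), sub_eq_add_neg, phaseSpace_neg]

theorem charFn_pauli {n : ℕ} (a v : PhaseSpace n) :
    charFn (pauli a) v = if v = a then (2 : ℂ) ^ n else 0 := by
  rw [charFn_eq]
  by_cases h : v = a
  · rw [if_pos h, h, pauli_mul_self, ← pauli_zero, trace_pauli, if_pos rfl]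
  · rw [if_neg h, pauli_mul, Matrix.trace_smul, trace_pauli,
      if_neg (fun h' => h (phaseSpace_add_eq_zero.1 h').symm), smul_zero]

/-- Fourier inversion: the operator `2⁻ⁿ ∑ f(v) w(v)` has characteristic function `f`. -/
theorem charFn_sum_smul_pauli {n : ℕ} (f : PhaseSpace n → ℂ) (v : PhaseSpace n) :
    charFn (((2 : ℂ) ^ n)⁻¹ • ∑ u, f u • pauli u) v = f v := by
  rw [charFn_smul, charFn_sum]
  simp only [charFn_smul, charFn_pauli, mul_ite, mul_zero]
  rw [Finset.sum_ite_eq Finset.univ v, if_pos (Finset.mem_univ _)]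
  field_simp

theorem charFn_meanState {n : ℕ} (A : Op n) (v : PhaseSpace n) :
    charFn (meanState A) v = meanCharFn A v :=
  charFn_sum_smul_pauli _ _

theorem charFn_transpose {n : ℕ} (A : Op n) (v : PhaseSpace n) :
    charFn Aᵀ v = chi v.1 v.2 * charFn A v := by
  have h : pauli v = chi v.1 v.2 • (pauli v)ᵀ := by
    rw [pauli_transpose, smul_smul, chi_mul_self, one_smul]
  conv_lhs => rw [charFn_eq, h]
  rw [charFn_eq, Matrix.mul_smul, Matrix.trace_smul, ← Matrix.transpose_mul,
    Matrix.trace_transpose, Matrix.trace_mul_comm, smul_eq_mul]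

theorem charFn_pauli_conj {n : ℕ} (A : Op n) (u v : PhaseSpace n) :
    charFn (pauli u * A * pauli u) v = comSign u v * charFn A v := by
  have h : comSign u v * charFn A v = (A * (pauli u * pauli v * pauli u)).trace := by
    rw [pauli_conj, Matrix.mul_smul, Matrix.trace_smul, ← charFn_eq, smul_eq_mul]
  rw [h, charFn_eq, Matrix.mul_assoc, Matrix.mul_assoc, Matrix.trace_mul_comm]
  simp only [Matrix.mul_assoc]

theorem star_charFn {n : ℕ} {A : Op n} (hA : A.IsHermitian) (v : PhaseSpace n) :
    star (charFn A v) = charFn A v := by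
  rw [charFn_eq, ← Matrix.trace_conjTranspose, Matrix.conjTranspose_mul, pauli_conjTranspose,
    hA.eq, Matrix.trace_mul_comm]

theorem charFn_eq_ofReal {n : ℕ} {A : Op n} (hA : A.IsHermitian) (v : PhaseSpace n) :
    charFn A v = ((charFn A v).re : ℂ) :=
  (Complex.conj_eq_iff_re.1 (star_charFn hA v)).symm

theorem charFn_sq_of_norm_eq_one {n : ℕ} {A : Op n} (hA : A.IsHermitian) {v : PhaseSpace n}
    (h : ‖charFn A v‖ = 1) : charFn A v ^ 2 = 1 := by
  rw [sq]
  nth_rewrite 2 [← star_charFn hA v]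
  rw [Complex.star_def, Complex.mul_conj, Complex.normSq_eq_norm_sq, h]
  simp

theorem posSemidef_one_add_smul_pauli {n : ℕ} (c : ℝ) (hc : c ^ 2 = 1) (v : PhaseSpace n) :
    (1 + (c : ℂ) • pauli v).PosSemidef := by
  have h : 1 + (c : ℂ) • pauli v =
      (2⁻¹ : ℝ) • ((1 + (c : ℂ) • pauli v)ᴴ * (1 + (c : ℂ) • pauli v)) := by
    have hc' : (c : ℂ) * c = 1 := by rw [← sq]; exact_mod_cast hc
    rw [Matrix.conjTranspose_add, Matrix.conjTranspose_smul, pauli_conjTranspose,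
      Matrix.conjTranspose_one, Complex.star_def, Complex.conj_ofReal, add_mul, mul_add, mul_add,
      Matrix.smul_mul, Matrix.smul_mul, Matrix.mul_smul, Matrix.mul_smul, pauli_mul_self, smul_smul,
      hc', one_smul, one_mul, one_mul, mul_one]
    ext i j
    simp only [Matrix.add_apply, Matrix.smul_apply, Complex.real_smul]
    push_cast
    ring
  rw [h]
  exact (Matrix.posSemidef_conjTranspose_mul_self _).smul (by norm_num)

theorem trace_mul_nonneg {m : Type*} [Fintype m] {A B : Matrix m m ℂ}
    (hA : A.PosSemidef) (hB : B.PosSemidef) : 0 ≤ (A * B).trace := by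
  obtain ⟨k, w, rfl⟩ := Matrix.posSemidef_iff_eq_sum_vecMulVec.1 hA
  rw [Matrix.sum_mul, Matrix.trace_sum]
  refine Finset.sum_nonneg fun i _ => ?_
  rw [Matrix.trace_mul_comm, Matrix.mul_vecMulVec, Matrix.trace_vecMulVec, dotProduct_comm]
  exact hB.dotProduct_mulVec_nonneg _

/-- The characteristic function of a state is bounded by `1`, because `1 ± w(v)` is positive. -/
theorem norm_charFn_le_one {n : ℕ} {A : Op n} (hA : IsState A) (v : PhaseSpace n) :
    ‖charFn A v‖ ≤ 1 := by
  have key : ∀ c : ℝ, c ^ 2 = 1 → 0 ≤ 1 + c * (charFn A v).re := by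
    intro c hc
    have h := trace_mul_nonneg hA.1 (posSemidef_one_add_smul_pauli c hc v)
    rw [mul_add, mul_one, Matrix.trace_add, hA.2, Matrix.mul_smul, Matrix.trace_smul,
      ← charFn_eq, charFn_eq_ofReal hA.1.1, smul_eq_mul] at h
    exact_mod_cast h
  rw [charFn_eq_ofReal hA.1.1, Complex.norm_real, Real.norm_eq_abs, abs_le]
  have h1 := key 1 (by norm_num)
  have h2 := key (-1) (by norm_num)
  constructor <;> linarith

/-! ### The key unitary as a permutation of basis vectors -/

/-- The matrix of the linear map that sends the basis vector `|x⟩` to `|f x⟩`. -/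
def funMatrix {ι : Type*} [DecidableEq ι] (f : ι → ι) : Matrix ι ι ℂ :=
  Matrix.of fun y x => if y = f x then 1 else 0

theorem funMatrix_mul {ι : Type*} [Fintype ι] [DecidableEq ι] (f g : ι → ι) :
    funMatrix f * funMatrix g = funMatrix (f ∘ g) := by
  ext y x
  simp [funMatrix, Matrix.mul_apply]

theorem funMatrix_id {ι : Type*} [DecidableEq ι] : funMatrix (id : ι → ι) = 1 := by
  ext y x
  simp [funMatrix, Matrix.one_apply]

theorem cnot_eq {K : ℕ} (c t : Fin K) :
    cnot c t = funMatrix fun x => Function.update x t (x t + x c) := rfl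

/-- The gates `CNOT_{1 → i}` with `i` in a list add the first bit to the bits of the list. -/
theorem prod_cnot_fanOut {m : ℕ} (l : List (Fin m)) (hl : l.Nodup) :
    (l.map fun i => cnot (0 : Fin (m + 1)) i.succ).prod =
      funMatrix fun x => Fin.cons (α := fun _ => ZMod 2) (x 0)
        fun i => if i ∈ l then x i.succ + x 0 else x i.succ := by
  induction l with
  | nil =>
    simp only [List.map_nil, List.prod_nil, ← funMatrix_id]
    congr 1
    funext x k
    cases k using Fin.cases <;> simp
  | cons a l ih =>
    rw [List.nodup_cons] at hl
    rw [List.map_cons, List.prod_cons, ih hl.2, cnot_eq, funMatrix_mul]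
    congr 1
    funext x k
    cases k using Fin.cases with
    | zero => simp [(Fin.succ_ne_zero _).symm]
    | succ i =>
      by_cases hi : i = a
      · subst hi; simp [hl.1]
      · simp [hi]

/-- The gates `CNOT_{j → 1}` with `j` in a list add the bits of the list to the first bit. -/
theorem prod_cnot_fanIn {m : ℕ} (l : List (Fin m)) :
    (l.map fun j => cnot j.succ (0 : Fin (m + 1))).prod =
      funMatrix fun x => Fin.cons (α := fun _ => ZMod 2) (x 0 + (l.map fun j => x j.succ).sum)
        fun i => x i.succ := by
  induction l with
  | nil =>
    simp only [List.map_nil, List.prod_nil, ← funMatrix_id]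
    congr 1
    funext x k
    cases k using Fin.cases <;> simp
  | cons a l ih =>
    rw [List.map_cons, List.prod_cons, ih, cnot_eq, funMatrix_mul]
    congr 1
    funext x k
    cases k using Fin.cases with
    | zero => simp; ring
    | succ i => simp [Fin.succ_ne_zero]

/-- The permutation `(x₁, x₂, …, x_K) ↦ (∑ xₖ, x₂ + x₁, …, x_K + x₁)` of the basis labels that
underlies the key unitary, for an arbitrary alphabet. -/
def keyMap {α : Type*} [AddCommMonoid α] {m : ℕ} (x : Fin (m + 1) → α) : Fin (m + 1) → α :=
  Fin.cons (∑ k, x k) fun i => x i.succ + x 0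

theorem keyU_eq (N : ℕ) : keyU N = funMatrix keyMap := by
  rw [keyU, prod_cnot_fanOut _ (List.nodup_finRange _), prod_cnot_fanIn, funMatrix_mul]
  congr 1
  funext x k
  cases k using Fin.cases with
  | zero =>
    -- the first bit is added an even number of times to itself
    have h2 : ((2 * N : ℕ) : ZMod 2) = 0 := by
      rw [Nat.cast_mul]; exact zero_mul _
    simp only [keyMap, Function.comp, Fin.cons_zero, Fin.cons_succ, List.mem_finRange, if_true]
    rw [← List.ofFn_eq_map, List.sum_ofFn, Finset.sum_add_distrib, Fin.sum_univ_succ]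
    simp only [Finset.sum_const, Finset.card_univ, Fintype.card_fin, nsmul_eq_mul, h2, zero_mul,
      add_zero]
  | succ i => simp [keyMap]

theorem keyV_eq (N n : ℕ) : keyV N n = funMatrix keyMap := by
  ext y x
  have h : ∀ a : Fin n, ((fun k => y k a) = keyMap fun k => x k a) ↔
      ∀ k, y k a = keyMap x k a := by
    intro a
    rw [funext_iff]
    refine forall_congr' fun k => ?_
    cases k using Fin.cases <;> simp [keyMap]
  simp only [keyV, keyU_eq, funMatrix, Matrix.of_apply, h]
  rw [Finset.prod_ite_zero]
  simp only [Finset.prod_const_one, Finset.mem_univ, true_implies, funext_iff]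
  congr 1
  exact propext forall_comm

/-! ### The characteristic function of a convolution -/

/-- The partial trace forces the arguments of a Pauli entry to differ by the same shift in
every system. -/
theorem keyMap_tail_eq_and_iff {N n : ℕ} (x y : Fin (2 * N + 1) → Bits n) (q : Bits n) :
    ((fun i : Fin (2 * N) => keyMap x i.succ) = (fun i : Fin (2 * N) => keyMap y i.succ) ∧
      ∑ k, y k = ∑ k, x k + q) ↔ ∀ k, y k = x k + q := by
  have h2 : ∀ b : Bits n, (2 * N) • b = 0 := by
    intro b
    rw [mul_comm, mul_nsmul, two_nsmul, ← nsmul_add, bits_add_self, nsmul_zero]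
  constructor
  · rintro ⟨h1, h3⟩
    have h4 : ∀ i : Fin (2 * N), y i.succ = x i.succ + (x 0 + y 0) := by
      intro i
      have := congrFun h1 i
      simp only [keyMap, Fin.cons_succ] at this
      rw [← add_assoc, this, bits_add_add]
    rw [Fin.sum_univ_succ, Fin.sum_univ_succ (f := x)] at h3
    simp only [h4, Finset.sum_add_distrib (g := fun _ => x 0 + y 0)] at h3
    rw [Finset.sum_const, Finset.card_univ, Fintype.card_fin, h2, add_zero, add_right_comm] at h3
    have h5 : y 0 = x 0 + q := add_right_cancel h3
    intro k
    cases k using Fin.cases with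
    | zero => exact h5
    | succ i => rw [h4, h5, ← add_assoc (x 0), bits_add_self, zero_add]
  · intro h
    refine ⟨?_, ?_⟩
    · funext i
      simp only [keyMap, Fin.cons_succ, h]
      rw [add_add_add_comm, bits_add_self, add_zero]
    · simp only [h, Finset.sum_add_distrib, Finset.sum_const, Finset.card_univ, Fintype.card_fin,
        add_nsmul, h2, one_nsmul, zero_add]

theorem funMatrix_conj_apply {ι : Type*} [Fintype ι] [DecidableEq ι] (f : ι → ι)
    (T : Matrix ι ι ℂ) (a b : ι) :
    (funMatrix f * T * (funMatrix f)ᴴ) a b =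
      ∑ x, ∑ y, if a = f x ∧ b = f y then T x y else 0 := by
  simp only [Matrix.mul_apply, funMatrix, Matrix.conjTranspose_apply, Matrix.of_apply,
    Finset.sum_mul]
  rw [Finset.sum_comm]
  refine Finset.sum_congr rfl fun x _ => Finset.sum_congr rfl fun y _ => ?_
  by_cases h1 : a = f x <;> by_cases h2 : b = f y <;> simp [h1, h2]

/-- Expectation values of the first system, pulled back along the key unitary. -/
theorem trace_convolution_mul {N n : ℕ} (ρ : Fin (2 * N + 1) → Op n) (B : Op n) :
    (convolution N ρ * B).trace = ∑ x, ∑ y, tensor ρ x y *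
      if (fun i : Fin (2 * N) => keyMap x i.succ) = (fun i : Fin (2 * N) => keyMap y i.succ)
      then B (∑ k, y k) (∑ k, x k) else 0 := by
  have h1 : ∀ (s t : Bits n) (z : Fin (2 * N) → Bits n) (x y : Fin (2 * N + 1) → Bits n),
      (Fin.cons (α := fun _ => Bits n) s z = keyMap x ∧
        Fin.cons (α := fun _ => Bits n) t z = keyMap y) ↔
      s = ∑ k, x k ∧ t = ∑ k, y k ∧ z = (fun i : Fin (2 * N) => keyMap x i.succ) ∧
        z = (fun i : Fin (2 * N) => keyMap y i.succ) := by
    intro s t z x y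
    have : ∀ (s : Bits n) (x : Fin (2 * N + 1) → Bits n),
        Fin.cons (α := fun _ => Bits n) s z = keyMap x ↔
          s = ∑ k, x k ∧ z = (fun i : Fin (2 * N) => keyMap x i.succ) := by
      intro s x
      simp only [keyMap, Fin.cons_succ]
      exact Fin.cons_inj
    rw [this, this]
    tauto
  have h2 : (convolution N ρ * B).trace = ∑ s, ∑ t, ∑ z, ∑ x, ∑ y,
      if s = ∑ k, x k ∧ t = ∑ k, y k ∧ z = (fun i : Fin (2 * N) => keyMap x i.succ) ∧
        z = (fun i : Fin (2 * N) => keyMap y i.succ) then tensor ρ x y * B t s else 0 := by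
    simp only [Matrix.trace, Matrix.diag_apply, Matrix.mul_apply (M := convolution N ρ)]
    simp only [convolution, partialTrace, Matrix.of_apply, keyV_eq, funMatrix_conj_apply, h1,
      Finset.sum_mul, ite_mul, zero_mul]
  have h3 : ∀ F : Bits n → Bits n → (Fin (2 * N) → Bits n) → (Fin (2 * N + 1) → Bits n) →
      (Fin (2 * N + 1) → Bits n) → ℂ,
      ∑ s, ∑ t, ∑ z, ∑ x, ∑ y, F s t z x y = ∑ x, ∑ y, ∑ s, ∑ t, ∑ z, F s t z x y := by
    intro F
    simp only [← Fintype.sum_prod_type']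
    refine Fintype.sum_equiv
      ⟨fun p => ⟨p.2.2.2.1, p.2.2.2.2, p.1, p.2.1, p.2.2.1⟩,
        fun p => ⟨p.2.2.1, p.2.2.2.1, p.2.2.2.2, p.1, p.2.1⟩, fun _ => rfl, fun _ => rfl⟩ _ _
      fun _ => rfl
  rw [h2, h3]
  refine Finset.sum_congr rfl fun x _ => Finset.sum_congr rfl fun y _ => ?_
  simp only [ite_and]
  rw [Finset.sum_eq_single (∑ k, x k), Finset.sum_eq_single (∑ k, y k),
    Finset.sum_eq_single (fun i : Fin (2 * N) => keyMap x i.succ)]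
  · simp
  · intro z _ hz; simp [hz]
  · intro h; exact absurd (Finset.mem_univ _) h
  · intro t _ ht; simp [ht]
  · intro h; exact absurd (Finset.mem_univ _) h
  · intro s _ hs; simp [hs]
  · intro h; exact absurd (Finset.mem_univ _) h

/-- The convolution multiplies characteristic functions, up to the sign `(-1)^{N p·q}`. -/
theorem charFn_convolution {N n : ℕ} (ρ : Fin (2 * N + 1) → Op n) (v : PhaseSpace n) :
    charFn (convolution N ρ) v = chi v.1 v.2 ^ N * ∏ k, charFn (ρ k) v := by
  have h1 : ∏ k, charFn (ρ k) v =
      ∑ x : Fin (2 * N + 1) → Bits n, ∑ y : Fin (2 * N + 1) → Bits n,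
        ∏ k, (ρ k (x k) (y k) * pauli v (y k) (x k)) := by
    simp only [charFn_eq_sum]
    rw [Finset.prod_univ_sum, Fintype.piFinset_univ]
    refine Finset.sum_congr rfl fun x _ => ?_
    rw [Finset.prod_univ_sum, Fintype.piFinset_univ]
  rw [charFn_eq, trace_convolution_mul, h1, Finset.mul_sum]
  refine Finset.sum_congr rfl fun x _ => ?_
  rw [Finset.mul_sum]
  refine Finset.sum_congr rfl fun y _ => ?_
  rw [Finset.prod_mul_distrib, tensor, Matrix.of_apply, mul_left_comm]
  congr 1
  simp only [pauli_apply]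
  rw [← ite_and]
  simp only [keyMap_tail_eq_and_iff]
  rw [Finset.prod_ite_zero]
  simp only [Finset.mem_univ, true_implies]
  by_cases h : ∀ k, y k = x k + v.2
  · rw [if_pos h, if_pos h, Finset.prod_mul_distrib, chi_sum_right, Finset.prod_const,
      Finset.card_univ, Fintype.card_fin, pow_succ, pow_mul, sq (phase v), phase_mul_self]
    have : chi v.1 v.2 ^ N * chi v.1 v.2 ^ N = 1 := by rw [← mul_pow, chi_mul_self, one_pow]
    linear_combination -(phase v * ∏ k, chi v.1 (y k)) * this
  · rw [if_neg h, if_neg h, mul_zero]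

theorem charFn_conv3 {n : ℕ} (ρ : Fin 3 → Op n) (v : PhaseSpace n) :
    charFn (conv3 ρ) v = chi v.1 v.2 * ∏ k, charFn (ρ k) v := by
  rw [conv3, charFn_convolution, pow_one]

/-! ### Doubly stochastic matrices, majorization and entropy -/

/-- In a decreasing list of nonnegative numbers, the first `k` entries have the largest sum among
all sub-multisets of at most `k` entries. -/
theorem sum_le_sum_take {L : List ℝ} (hs : L.Pairwise (· ≥ ·)) (h0 : ∀ a ∈ L, 0 ≤ a) :
    ∀ (k : ℕ) (m : Multiset ℝ), m ≤ ↑L → m.card ≤ k → m.sum ≤ (L.take k).sum := by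
  induction L with
  | nil =>
    intro k m hm _
    simp [Multiset.le_zero.1 hm]
  | cons a L ih =>
    rw [List.pairwise_cons] at hs
    have ih' := ih hs.2 fun b hb => h0 b (List.mem_cons_of_mem _ hb)
    rintro (_ | k) m hm hk
    · simp [Multiset.card_eq_zero.1 (Nat.le_zero.1 hk)]
    rw [List.take_succ_cons, List.sum_cons]
    rw [← Multiset.cons_coe] at hm
    by_cases ha : a ∈ m
    · obtain ⟨m', rfl⟩ := Multiset.exists_cons_of_mem ha
      rw [Multiset.card_cons] at hk
      rw [Multiset.sum_cons]
      exact add_le_add_right (ih' k m' ((Multiset.cons_le_cons_iff a).1 hm) (by omega)) _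
    · have hm' := (Multiset.le_cons_of_notMem ha).1 hm
      rcases Multiset.empty_or_exists_mem m with rfl | ⟨b, hb⟩
      · rw [Multiset.sum_zero]
        exact add_nonneg (h0 a List.mem_cons_self) (List.sum_nonneg fun b hb =>
          h0 b (List.mem_cons_of_mem _ (List.mem_of_mem_take hb)))
      · obtain ⟨m', rfl⟩ := Multiset.exists_cons_of_mem hb
        rw [Multiset.card_cons] at hk
        rw [Multiset.sum_cons]
        exact add_le_add (hs.1 b (Multiset.mem_coe.1 (Multiset.mem_of_le hm' hb)))
          (ih' k m' ((Multiset.le_cons_self _ _).trans hm') (by omega))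

theorem sum_le_sumLargest {ι : Type*} [Fintype ι] {p : ι → ℝ} (hp : ∀ i, 0 ≤ p i)
    {k : ℕ} {A : Finset ι} (hA : A.card ≤ k) : ∑ i ∈ A, p i ≤ sumLargest p k := by
  refine sum_le_sum_take (Multiset.pairwise_sort _ _) (fun a ha => ?_) k (A.val.map p) ?_ ?_
  · rw [Multiset.mem_sort, Multiset.mem_map] at ha
    obtain ⟨i, _, rfl⟩ := ha
    exact hp i
  · rw [Multiset.sort_eq]
    exact Multiset.map_le_map (Finset.val_le_iff.2 (Finset.subset_univ A))
  · rwa [Multiset.card_map]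

theorem exists_sumLargest_eq {ι : Type*} [Fintype ι] (p : ι → ℝ) (k : ℕ) :
    ∃ A : Finset ι, A.card ≤ k ∧ sumLargest p k = ∑ i ∈ A, p i := by
  classical
  set L := (Finset.univ.val.map p).sort (· ≥ ·) with hL
  have h1 : L.Perm ((Finset.univ : Finset ι).toList.map p) := by
    rw [← Multiset.coe_eq_coe, hL, Multiset.sort_eq, ← Multiset.map_coe, Finset.coe_toList]
  obtain ⟨l, hl1, hl2⟩ := (List.take_sublist k L).subperm.trans h1.subperm
  obtain ⟨l', hl', rfl⟩ := List.sublist_map_iff.1 hl2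
  have hnd : l'.Nodup := (Finset.nodup_toList _).sublist hl'
  refine ⟨l'.toFinset, ?_, ?_⟩
  · rw [List.toFinset_card_of_nodup hnd, ← List.length_map (f := p), hl1.length_eq]
    exact List.length_take_le _ _
  · rw [List.sum_toFinset _ hnd, hl1.sum_eq]
    rfl

/-- A doubly stochastic matrix only decreases the sums of largest components: by Birkhoff's
theorem its action is an average of permutations. -/
theorem sumLargest_mulVec_le {ι : Type*} [Fintype ι] [DecidableEq ι] {D : Matrix ι ι ℝ}
    (hD : D ∈ doublyStochastic ℝ ι) {q : ι → ℝ} (hq : ∀ i, 0 ≤ q i) (k : ℕ) :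
    sumLargest (D *ᵥ q) k ≤ sumLargest q k := by
  obtain ⟨A, hA, hAe⟩ := exists_sumLargest_eq (D *ᵥ q) k
  obtain ⟨w, hw0, hw1, rfl⟩ := exists_eq_sum_perm_of_mem_doublyStochastic hD
  have h : ∑ i ∈ A, ((∑ σ : Equiv.Perm ι, w σ • σ.permMatrix ℝ) *ᵥ q) i =
      ∑ σ : Equiv.Perm ι, w σ * ∑ i ∈ A.map σ.toEmbedding, q i := by
    simp only [Matrix.sum_mulVec, Matrix.smul_mulVec, Matrix.permMatrix_mulVec,
      Finset.sum_apply, Pi.smul_apply, smul_eq_mul, Finset.sum_map, Finset.mul_sum]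
    rw [Finset.sum_comm]
    rfl
  rw [hAe, h]
  calc _ ≤ ∑ σ : Equiv.Perm ι, w σ * sumLargest q k :=
        Finset.sum_le_sum fun σ _ => mul_le_mul_of_nonneg_left
          (sum_le_sumLargest hq (by rwa [Finset.card_map])) (hw0 σ)
    _ = sumLargest q k := by rw [← Finset.sum_mul, hw1, one_mul]

theorem sum_le_sum_of_concaveOn {ι : Type*} [Fintype ι] [DecidableEq ι] {D : Matrix ι ι ℝ}
    (hD : D ∈ doublyStochastic ℝ ι) {q : ι → ℝ} (hq : ∀ i, 0 ≤ q i) {f : ℝ → ℝ}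
    (hf : ConcaveOn ℝ (Set.Ici 0) f) : ∑ j, f (q j) ≤ ∑ i, f ((D *ᵥ q) i) := by
  calc ∑ j, f (q j) = ∑ j, (∑ i, D i j) * f (q j) := by
        simp only [sum_col_of_mem_doublyStochastic hD, one_mul]
    _ = ∑ i, ∑ j, D i j • f (q j) := by
        simp only [Finset.sum_mul, smul_eq_mul]
        exact Finset.sum_comm
    _ ≤ ∑ i, f ((D *ᵥ q) i) := Finset.sum_le_sum fun i _ =>
        hf.le_map_sum (fun j _ => nonneg_of_mem_doublyStochastic hD)
          (sum_row_of_mem_doublyStochastic hD i) fun j _ => hq j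

theorem sum_le_sum_of_convexOn {ι : Type*} [Fintype ι] [DecidableEq ι] {D : Matrix ι ι ℝ}
    (hD : D ∈ doublyStochastic ℝ ι) {q : ι → ℝ} (hq : ∀ i, 0 ≤ q i) {f : ℝ → ℝ}
    (hf : ConvexOn ℝ (Set.Ici 0) f) : ∑ i, f ((D *ᵥ q) i) ≤ ∑ j, f (q j) := by
  have h := sum_le_sum_of_concaveOn hD hq hf.neg
  simp only [Pi.neg_apply, Finset.sum_neg_distrib] at h
  exact neg_le_neg_iff.1 h

/-- The power function cut off to the support is concave for exponents in `[0, 1)`, including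
the exponent `0`, where it is the indicator function of `(0, ∞)`. -/
theorem concaveOn_rpow_support {a : ℝ} (h0 : 0 ≤ a) (h1 : a < 1) :
    ConcaveOn ℝ (Set.Ici 0) fun x : ℝ => if x ≠ 0 then x ^ a else 0 := by
  rcases h0.eq_or_lt with rfl | h0
  · refine ⟨convex_Ici 0, fun x hx y hy s t hs ht hst => ?_⟩
    simp only [Real.rpow_zero, smul_eq_mul]
    rw [Set.mem_Ici] at hx hy
    by_cases h : s * x + t * y = 0
    · have hsx : s * x = 0 := by linarith [mul_nonneg hs hx, mul_nonneg ht hy]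
      have hty : t * y = 0 := by linarith [mul_nonneg hs hx, mul_nonneg ht hy]
      rw [if_neg (not_not.2 h)]
      rcases mul_eq_zero.1 hsx with hs' | hx' <;> rcases mul_eq_zero.1 hty with ht' | hy' <;>
        simp_all
    · rw [if_pos h]
      have hx1 : s * (if x ≠ 0 then (1 : ℝ) else 0) ≤ s := by
        split_ifs <;> linarith
      have hy1 : t * (if y ≠ 0 then (1 : ℝ) else 0) ≤ t := by
        split_ifs <;> linarith
      linarith
  · have : (fun x : ℝ => if x ≠ 0 then x ^ a else 0) = fun x => x ^ a := by
      funext x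
      by_cases hx : x = 0
      · simp [hx, Real.zero_rpow h0.ne']
      · simp [hx]
    rw [this]
    exact Real.concaveOn_rpow h0.le h1.le

/-! ### Mixtures of unitary conjugations -/

/-- The vector of eigenvalues of a mixture `∑ c_u W_u B W_u†` of unitary conjugates of `B` is a
doubly stochastic image of that of `B`. -/
theorem exists_doublyStochastic_eigenvalues {ι κ : Type*} [Fintype ι] [DecidableEq ι] [Fintype κ]
    {A B : Matrix ι ι ℂ} (hA : A.IsHermitian) (hB : B.IsHermitian) (c : κ → ℝ)
    (hc0 : ∀ u, 0 ≤ c u) (hc1 : ∑ u, c u = 1) (W : κ → Matrix ι ι ℂ)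
    (hW : ∀ u, W u ∈ Matrix.unitaryGroup ι ℂ)
    (h : A = ∑ u, (c u : ℂ) • (W u * B * (W u)ᴴ)) :
    ∃ D ∈ doublyStochastic ℝ ι, hA.eigenvalues = D *ᵥ hB.eigenvalues := by
  set P : Matrix.unitaryGroup ι ℂ := hA.eigenvectorUnitary with hP
  set Q : Matrix.unitaryGroup ι ℂ := hB.eigenvectorUnitary with hQ
  -- the transition matrices between the two eigenbases
  let M : κ → Matrix.unitaryGroup ι ℂ := fun u => star P * ⟨W u, hW u⟩ * Q
  have hM : ∀ u, (M u : Matrix ι ι ℂ) = (P : Matrix ι ι ℂ)ᴴ * W u * Q := fun u => rfl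
  have hrow : ∀ u i, ∑ j, ‖(M u : Matrix ι ι ℂ) i j‖ ^ 2 = 1 := by
    intro u i
    have h1 := congrFun (congrFun (Matrix.mem_unitaryGroup_iff.1 (M u).2) i) i
    rw [Matrix.mul_apply, Matrix.one_apply_eq] at h1
    simp only [Matrix.star_apply, Complex.star_def, Complex.mul_conj,
      Complex.normSq_eq_norm_sq] at h1
    exact_mod_cast h1
  have hcol : ∀ u j, ∑ i, ‖(M u : Matrix ι ι ℂ) i j‖ ^ 2 = 1 := by
    intro u j
    have h1 := congrFun (congrFun (Matrix.mem_unitaryGroup_iff'.1 (M u).2) j) j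
    rw [Matrix.mul_apply, Matrix.one_apply_eq] at h1
    simp only [Matrix.star_apply, Complex.star_def, mul_comm ((starRingEnd ℂ) _),
      Complex.mul_conj, Complex.normSq_eq_norm_sq] at h1
    exact_mod_cast h1
  refine ⟨Matrix.of fun i j => ∑ u, c u * ‖(M u : Matrix ι ι ℂ) i j‖ ^ 2,
    mem_doublyStochastic_iff_sum.2 ⟨fun i j => ?_, fun i => ?_, fun j => ?_⟩, ?_⟩
  · exact Finset.sum_nonneg fun u _ => mul_nonneg (hc0 u) (by positivity)
  · simp only [Matrix.of_apply]
    rw [Finset.sum_comm]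
    simp only [← Finset.mul_sum, hrow, mul_one, hc1]
  · simp only [Matrix.of_apply]
    rw [Finset.sum_comm]
    simp only [← Finset.mul_sum, hcol, mul_one, hc1]
  · have hB' : B = (Q : Matrix ι ι ℂ) * Matrix.diagonal (fun j => (hB.eigenvalues j : ℂ)) *
        (Q : Matrix ι ι ℂ)ᴴ := hB.spectral_theorem
    have hA' : Matrix.diagonal (fun j => (hA.eigenvalues j : ℂ)) =
        (P : Matrix ι ι ℂ)ᴴ * A * (P : Matrix ι ι ℂ) := by
      rw [show Matrix.diagonal (fun j => (hA.eigenvalues j : ℂ)) =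
        Matrix.diagonal (RCLike.ofReal ∘ hA.eigenvalues) from rfl,
        ← hA.conjStarAlgAut_star_eigenvectorUnitary, Unitary.conjStarAlgAut_star_apply]
      rfl
    have hA'' : Matrix.diagonal (fun j => (hA.eigenvalues j : ℂ)) = ∑ u, (c u : ℂ) •
        ((M u : Matrix ι ι ℂ) * Matrix.diagonal (fun j => (hB.eigenvalues j : ℂ)) *
          (M u : Matrix ι ι ℂ)ᴴ) := by
      rw [hA']
      conv_lhs => rw [h, hB']
      rw [Matrix.mul_sum, Matrix.sum_mul]
      refine Finset.sum_congr rfl fun u _ => ?_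
      rw [Matrix.mul_smul, Matrix.smul_mul, hM]
      simp only [Matrix.conjTranspose_mul, Matrix.conjTranspose_conjTranspose, Matrix.mul_assoc]
    funext i
    have hi := congrFun (congrFun hA'' i) i
    rw [Matrix.diagonal_apply_eq, Matrix.sum_apply] at hi
    have e : ∀ u, ((c u : ℂ) • ((M u : Matrix ι ι ℂ) *
        Matrix.diagonal (fun j => (hB.eigenvalues j : ℂ)) * (M u : Matrix ι ι ℂ)ᴴ)) i i =
        ((∑ j, c u * ‖(M u : Matrix ι ι ℂ) i j‖ ^ 2 * hB.eigenvalues j : ℝ) : ℂ) := by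
      intro u
      rw [Matrix.smul_apply, Matrix.mul_apply, smul_eq_mul, Finset.mul_sum, Complex.ofReal_sum]
      refine Finset.sum_congr rfl fun j _ => ?_
      rw [Matrix.mul_diagonal, Matrix.conjTranspose_apply, mul_right_comm _ _ (star _),
        Complex.star_def, Complex.mul_conj, Complex.normSq_eq_norm_sq]
      push_cast
      ring
    simp only [e] at hi
    rw [← Complex.ofReal_sum, Complex.ofReal_inj] at hi
    rw [hi, Finset.sum_comm]
    simp only [Matrix.mulVec, dotProduct, Matrix.of_apply, Finset.sum_mul]

theorem IsState.eigenvalues_mem_stdSimplex {n : ℕ} {ρ : Op n} (h : IsState ρ) :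
    h.isHermitian.eigenvalues ∈ stdSimplex ℝ (Bits n) := by
  refine ⟨fun i => h.1.eigenvalues_nonneg i, ?_⟩
  have h1 := h.isHermitian.trace_eq_sum_eigenvalues
  rw [h.2] at h1
  have h2 : ((∑ i, h.isHermitian.eigenvalues i : ℝ) : ℂ) = ((1 : ℝ) : ℂ) := by
    rw [Complex.ofReal_sum, Complex.ofReal_one]
    exact h1.symm
  exact Complex.ofReal_injective h2

theorem mulVec_mem_stdSimplex {ι : Type*} [Fintype ι] [DecidableEq ι] {D : Matrix ι ι ℝ}
    (hD : D ∈ doublyStochastic ℝ ι) {q : ι → ℝ} (hq : q ∈ stdSimplex ℝ ι) :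
    D *ᵥ q ∈ stdSimplex ℝ ι :=
  ⟨fun i => Finset.sum_nonneg fun j _ => mul_nonneg (nonneg_of_mem_doublyStochastic hD) (hq.1 j),
    by rw [sum_mulVec_of_mem_doublyStochastic hD, hq.2]⟩

theorem sum_rpow_pos_of_mem_stdSimplex {ι : Type*} [Fintype ι] {p : ι → ℝ}
    (hp : p ∈ stdSimplex ℝ ι) (a : ℝ) : 0 < ∑ i, if p i ≠ 0 then p i ^ a else 0 := by
  have h0 : ∀ i, 0 ≤ if p i ≠ 0 then p i ^ a else 0 := fun i => by
    split_ifs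
    · exact Real.rpow_nonneg (hp.1 i) a
    · exact le_rfl
  obtain ⟨i, hi⟩ : ∃ i, p i ≠ 0 := by
    by_contra! h
    have := hp.2
    simp [h] at this
  refine Finset.sum_pos' (fun i _ => h0 i) ⟨i, Finset.mem_univ _, ?_⟩
  rw [if_pos hi]
  exact Real.rpow_pos_of_pos ((hp.1 i).lt_of_ne' hi) a

/-- Schur concavity of the Rényi entropies. -/
theorem renyiEntropy_le_of_doublyStochastic {n : ℕ} {ρ σ : Op n} (hρ : IsState ρ)
    (hσ : σ.IsHermitian) {D : Matrix (Bits n) (Bits n) ℝ} (hD : D ∈ doublyStochastic ℝ (Bits n))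
    (h : hσ.eigenvalues = D *ᵥ hρ.isHermitian.eigenvalues) (α : ℝ≥0∞) :
    renyiEntropy α ρ hρ.isHermitian ≤ renyiEntropy α σ hσ := by
  have hq := hρ.eigenvalues_mem_stdSimplex
  have hp := mulVec_mem_stdSimplex hD hq
  simp only [renyiEntropy, h]
  generalize hρ.isHermitian.eigenvalues = q at hq hp
  simp only [Finset.sum_filter]
  split_ifs with h1 h2
  · -- each component of `D q` is an average of components of `q`
    have hbdd : BddAbove (Set.range q) := Set.finite_range q |>.bddAbove
    have hle : (⨆ i, (D *ᵥ q) i) ≤ ⨆ i, q i := by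
      refine ciSup_le fun i => ?_
      calc (D *ᵥ q) i ≤ ∑ j, D i j * ⨆ i, q i :=
            Finset.sum_le_sum fun j _ => mul_le_mul_of_nonneg_left (le_ciSup hbdd j)
              (nonneg_of_mem_doublyStochastic hD)
        _ = ⨆ i, q i := by rw [← Finset.sum_mul, sum_row_of_mem_doublyStochastic hD, one_mul]
    have hpos : 0 < ⨆ i, (D *ᵥ q) i := by
      by_contra! hn
      have h0 : ∀ i, (D *ᵥ q) i = 0 := fun i =>
        le_antisymm ((le_ciSup (Set.finite_range (D *ᵥ q)).bddAbove i).trans hn) (hp.1 i)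
      have := hp.2
      simp [h0] at this
    exact neg_le_neg (Real.log_le_log hpos hle)
  · have := sum_le_sum_of_concaveOn hD hq.1 Real.concaveOn_negMulLog
    simpa only [Real.negMulLog, neg_mul, Finset.sum_neg_distrib] using this
  · rcases lt_or_gt_of_ne h2 with h3 | h3
    · have h4 : α.toReal < 1 := by
        have := (ENNReal.toReal_lt_toReal h1 ENNReal.one_ne_top).2 h3
        simpa using this
      exact mul_le_mul_of_nonneg_left (Real.log_le_log (sum_rpow_pos_of_mem_stdSimplex hq _)
        (sum_le_sum_of_concaveOn hD hq.1 (concaveOn_rpow_support ENNReal.toReal_nonneg h4)))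
        (inv_nonneg.2 (by linarith))
    · have h4 : 1 < α.toReal := by
        have := (ENNReal.toReal_lt_toReal ENNReal.one_ne_top h1).2 h3
        simpa using this
      have e : (fun x : ℝ => if x ≠ 0 then x ^ α.toReal else 0) = fun x => x ^ α.toReal := by
        funext x
        by_cases hx : x = 0
        · simp [hx, Real.zero_rpow (by linarith : α.toReal ≠ 0)]
        · simp [hx]
      refine mul_le_mul_of_nonpos_left (Real.log_le_log (sum_rpow_pos_of_mem_stdSimplex hp _)
        (sum_le_sum_of_convexOn hD hq.1
          (f := fun x : ℝ => if x ≠ 0 then x ^ α.toReal else 0) ?_))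
        (inv_nonpos.2 (by linarith))
      rw [e]
      exact convexOn_rpow h4.le

/-! ### The convolution as a mixture of Pauli conjugations -/

theorem pauli_mem_unitaryGroup {n : ℕ} (v : PhaseSpace n) :
    pauli v ∈ Matrix.unitaryGroup (Bits n) ℂ := by
  rw [Matrix.mem_unitaryGroup_iff, Matrix.star_eq_conjTranspose, pauli_conjTranspose,
    pauli_mul_self]

/-- For fixed states `ρ₂` and `ρ₃`, the convolution is a mixture of Pauli conjugations of `ρ₁`.
The weights are the Fourier coefficients of the multiplier `Ξ_{ρ₂ᵀ} Ξ_{ρ₃}`; by Parseval's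
identity they are the overlaps `2⁻ⁿ Tr[ρ₂ᵀ w(u) ρ₃ w(u)†]`, which are nonnegative. -/
theorem exists_conv3_eq_sum_pauli_conj {n : ℕ} {ρ : Fin 3 → Op n} (h1 : IsState (ρ 1))
    (h2 : IsState (ρ 2)) :
    ∃ c : PhaseSpace n → ℝ, (∀ u, 0 ≤ c u) ∧ ∑ u, c u = 1 ∧
      conv3 ρ = ∑ u, (c u : ℂ) • (pauli u * ρ 0 * pauli u) := by
  let T : PhaseSpace n → ℂ := fun u => ((ρ 1)ᵀ * (pauli u * ρ 2 * pauli u)).trace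
  have hT0 : ∀ u, 0 ≤ T u := by
    intro u
    refine trace_mul_nonneg h1.1.transpose ?_
    have := h2.1.mul_mul_conjTranspose_same (pauli u)
    rwa [pauli_conjTranspose] at this
  have hTre : ∀ u, ((T u).re : ℂ) = T u := fun u =>
    (Complex.eq_re_of_ofReal_le (r := 0) (by simpa using hT0 u)).symm
  let c : PhaseSpace n → ℝ := fun u => (2 ^ n)⁻¹ * (T u).re
  let f : PhaseSpace n → ℂ := fun v => chi v.1 v.2 * charFn (ρ 1) v * charFn (ρ 2) v
  have hc : ∀ u, (c u : ℂ) = ((4 : ℂ) ^ n)⁻¹ * ∑ v, comSign u v * f v := by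
    intro u
    have hP := parseval (ρ 1)ᵀ (pauli u * ρ 2 * pauli u)
    have hH : (pauli u * ρ 2 * pauli u).IsHermitian := by
      rw [Matrix.IsHermitian, Matrix.conjTranspose_mul, Matrix.conjTranspose_mul,
        pauli_conjTranspose, h2.1.1.eq, Matrix.mul_assoc]
    simp only [hH.eq, charFn_transpose, charFn_pauli_conj, star_mul', star_comSign,
      star_charFn h2.1.1] at hP
    have h4 : (4 : ℂ) ^ n = 2 ^ n * 2 ^ n := by rw [← mul_pow]; norm_num
    have hs : ∑ v, comSign u v * f v = 2 ^ n * T u := by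
      rw [← hP]
      exact Finset.sum_congr rfl fun v _ => by simp only [f]; ring
    rw [hs, h4]
    simp only [c]
    push_cast
    rw [hTre]
    field_simp
  have hsum : ∀ v, ∑ u, (c u : ℂ) * comSign u v = f v := by
    intro v
    have e : ∀ u, (c u : ℂ) * comSign u v = ((4 : ℂ) ^ n)⁻¹ * ∑ v', f v' * comSign u (v' + v) := by
      intro u
      rw [hc, mul_assoc, Finset.sum_mul]
      congr 1
      exact Finset.sum_congr rfl fun v' _ => by rw [comSign_add_right]; ring
    simp only [e]
    rw [← Finset.mul_sum, Finset.sum_comm]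
    simp only [← Finset.mul_sum, sum_comSign, phaseSpace_add_eq_zero, mul_ite, mul_zero]
    rw [Finset.sum_ite_eq' Finset.univ v, if_pos (Finset.mem_univ _)]
    field_simp
  refine ⟨c, fun u => mul_nonneg (by positivity) (Complex.nonneg_iff.1 (hT0 u)).1, ?_, ?_⟩
  · have h := hsum 0
    simp only [f, comSign, Prod.fst_zero, Prod.snd_zero, chi_zero_left, chi_zero_right, charFn_zero,
      h1.2, h2.2, mul_one] at h
    exact_mod_cast h
  · refine charFn_injective fun v => ?_
    rw [charFn_conv3, charFn_sum]
    simp only [charFn_smul, charFn_pauli_conj, ← mul_assoc]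
    rw [← Finset.sum_mul, hsum, Fin.prod_univ_three]
    simp only [f]
    ring

theorem conv3_perm {n : ℕ} (ρ : Fin 3 → Op n) (π : Equiv.Perm (Fin 3)) :
    conv3 ρ = conv3 fun i => ρ (π i) := by
  refine charFn_injective fun v => ?_
  rw [charFn_conv3, charFn_conv3, Equiv.prod_comp π fun k => charFn (ρ k) v]

theorem exists_doublyStochastic_conv3 {n : ℕ} {ρ : Fin 3 → Op n} (hρ : ∀ i, IsState (ρ i))
    (j : Fin 3) : ∃ D ∈ doublyStochastic ℝ (Bits n),
      (conv3_isHermitian hρ).eigenvalues = D *ᵥ (hρ j).isHermitian.eigenvalues := by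
  obtain ⟨c, hc0, hc1, h⟩ := exists_conv3_eq_sum_pauli_conj
    (ρ := fun i => ρ (Equiv.swap 0 j i)) (hρ _) (hρ _)
  rw [← conv3_perm] at h
  simp only [Equiv.swap_apply_left] at h
  refine exists_doublyStochastic_eigenvalues (conv3_isHermitian hρ) (hρ j).isHermitian c hc0 hc1
    pauli pauli_mem_unitaryGroup ?_
  simpa only [pauli_conjTranspose] using h

/-! ### Pure states and stabilizer states -/

theorem IsPureStabilizer.isPure {n : ℕ} {ρ : Op n} (h : IsPureStabilizer ρ) : IsPure ρ := by
  obtain ⟨_, ψ, _, _, h1, _, h2⟩ := h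
  exact ⟨ψ, h1, h2⟩

theorem IsPure.isState {n : ℕ} {ρ : Op n} (h : IsPure ρ) : IsState ρ := by
  obtain ⟨ψ, h1, rfl⟩ := h
  exact ⟨Matrix.posSemidef_vecMulVec_self_star ψ, by
    rw [Matrix.trace_vecMulVec, dotProduct_comm, h1]⟩

theorem IsPure.mul_self {n : ℕ} {ρ : Op n} (h : IsPure ρ) : ρ * ρ = ρ := by
  obtain ⟨ψ, h1, rfl⟩ := h
  rw [Matrix.vecMulVec_mul_vecMulVec, h1, one_smul]

theorem IsPure.transpose {n : ℕ} {ρ : Op n} (h : IsPure ρ) : IsPure ρᵀ := by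
  obtain ⟨ψ, h1, rfl⟩ := h
  exact ⟨star ψ, by rw [star_star, dotProduct_comm, h1], by
    rw [Matrix.transpose_vecMulVec, star_star]⟩

theorem IsPure.sum_norm_charFn_sq {n : ℕ} {ρ : Op n} (h : IsPure ρ) :
    ∑ v, ‖charFn ρ v‖ ^ 2 = 2 ^ n := by
  rw [QubitConv.sum_norm_charFn_sq, h.isState.isHermitian.eq, h.mul_self, h.isState.2]
  simp

theorem convex_isState (n : ℕ) : Convex ℝ {ρ : Op n | IsState ρ} := by
  intro A hA B hB s t hs ht hst
  refine ⟨(hA.1.smul hs).add (hB.1.smul ht), ?_⟩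
  rw [Matrix.trace_add, Matrix.trace_smul, Matrix.trace_smul, hA.2, hB.2, ← add_smul, hst, one_smul]

theorem IsStabilizer.isState {n : ℕ} {ρ : Op n} (h : IsStabilizer ρ) : IsState ρ :=
  convexHull_min (fun _ hσ => hσ.isPure.isState) (convex_isState n) h

theorem IsPureStabilizer.pauli_conj {n : ℕ} {ρ : Op n} (h : IsPureStabilizer ρ)
    (u : PhaseSpace n) : IsPureStabilizer (pauli u * ρ * pauli u) := by
  obtain ⟨S, ψ, h1, h2, h3, h4, rfl⟩ := h
  have hstar : star (pauli u *ᵥ ψ) = star ψ ᵥ* pauli u := by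
    rw [Matrix.star_mulVec, pauli_conjTranspose]
  refine ⟨S, pauli u *ᵥ ψ, h1, h2, ?_, fun a ha => ?_, ?_⟩
  · rw [hstar, Matrix.dotProduct_mulVec, Matrix.vecMul_vecMul, pauli_mul_self, Matrix.vecMul_one, h3]
  · obtain ⟨c, hc⟩ := h4 a ha
    refine ⟨comSign a u * c, ?_⟩
    rw [Matrix.mulVec_mulVec, pauli_mul_comm, Matrix.smul_mulVec, ← Matrix.mulVec_mulVec, hc,
      Matrix.mulVec_smul, smul_smul]
  · rw [hstar, Matrix.mul_vecMulVec, Matrix.vecMulVec_mul]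

theorem IsStabilizer.pauli_conj {n : ℕ} {ρ : Op n} (h : IsStabilizer ρ) (u : PhaseSpace n) :
    IsStabilizer (pauli u * ρ * pauli u) := by
  refine convexHull_min (t := {σ : Op n | IsStabilizer (pauli u * σ * pauli u)})
    (fun σ hσ => subset_convexHull ℝ _ (IsPureStabilizer.pauli_conj hσ u)) ?_ h
  intro A hA B hB s t hs ht hst
  have := (convex_convexHull ℝ {σ : Op n | IsPureStabilizer σ}) hA hB hs ht hst
  rw [Set.mem_ofPred_eq, Matrix.mul_add, Matrix.add_mul, Matrix.mul_smul, Matrix.mul_smul,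
    Matrix.smul_mul, Matrix.smul_mul]
  exact this

theorem isStabilizer_conv3 {n : ℕ} {ρ : Fin 3 → Op n} (h : ∀ i, IsStabilizer (ρ i)) :
    IsStabilizer (conv3 ρ) := by
  obtain ⟨c, hc0, hc1, hc⟩ := exists_conv3_eq_sum_pauli_conj (h 1).isState (h 2).isState
  rw [hc]
  simp only [Complex.coe_smul]
  exact (convex_convexHull ℝ _).sum_mem (fun u _ => hc0 u) hc1 fun u _ => (h 0).pauli_conj u

/-- Distinct pure states have overlap less than `1`. -/
theorem IsPure.re_trace_mul_lt_one {n : ℕ} {ρ σ : Op n} (hρ : IsPure ρ) (hσ : IsPure σ)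
    (h : σ ≠ ρ) : (ρ * σ).trace.re < 1 := by
  have h1 : 0 ≤ ((ρ - σ)ᴴ * (ρ - σ)).trace :=
    (Matrix.posSemidef_conjTranspose_mul_self _).trace_nonneg
  have h2 : ((ρ - σ)ᴴ * (ρ - σ)).trace ≠ 0 := fun h0 =>
    h (sub_eq_zero.1 (Matrix.trace_conjTranspose_mul_self_eq_zero_iff.1 h0)).symm
  have h3 : ((ρ - σ)ᴴ * (ρ - σ)).trace = 2 - 2 * (ρ * σ).trace := by
    rw [Matrix.conjTranspose_sub, hρ.isState.isHermitian.eq, hσ.isState.isHermitian.eq,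
      Matrix.sub_mul, Matrix.mul_sub, Matrix.mul_sub, hρ.mul_self, hσ.mul_self, Matrix.trace_sub,
      Matrix.trace_sub, Matrix.trace_sub, hρ.isState.2, hσ.isState.2, Matrix.trace_mul_comm σ ρ]
    ring
  have h4 := (Complex.lt_def.1 (lt_of_le_of_ne h1 h2.symm)).1
  rw [h3] at h4
  simp at h4
  linarith

/-- Pure states are extreme points, so a pure mixture of pure stabilizer states is one of them. -/
theorem IsStabilizer.isPureStabilizer {n : ℕ} {ρ : Op n} (h : IsStabilizer ρ) (hρ : IsPure ρ) :
    IsPureStabilizer ρ := by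
  by_contra hn
  have hconv : Convex ℝ {σ : Op n | (ρ * σ).trace.re < 1} := by
    intro A hA B hB s t hs ht hst
    rw [Set.mem_ofPred_eq] at hA hB ⊢
    rw [Matrix.mul_add, Matrix.mul_smul, Matrix.mul_smul, Matrix.trace_add, Matrix.trace_smul,
      Matrix.trace_smul, Complex.add_re, Complex.smul_re, Complex.smul_re]
    exact (convex_Iio (1 : ℝ)) hA hB hs ht hst
  have hmem : ρ ∈ {σ : Op n | (ρ * σ).trace.re < 1} := by
    refine convexHull_min (fun σ hσ => hρ.re_trace_mul_lt_one hσ.isPure ?_) hconv h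
    rintro rfl
    exact hn hσ
  rw [Set.mem_ofPred_eq, hρ.mul_self, hρ.isState.2] at hmem
  simp at hmem

theorem charFn_vecMulVec {n : ℕ} (ψ : Bits n → ℂ) (v : PhaseSpace n) :
    charFn (Matrix.vecMulVec ψ (star ψ)) v = star ψ ⬝ᵥ pauli v *ᵥ ψ := by
  rw [charFn_eq, Matrix.trace_mul_comm, Matrix.mul_vecMulVec, Matrix.trace_vecMulVec,
    dotProduct_comm]

theorem norm_charFn_eq_one_of_mulVec_eq_smul {n : ℕ} {ψ : Bits n → ℂ} (hψ : star ψ ⬝ᵥ ψ = 1)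
    {v : PhaseSpace n} {c : ℂ} (h : pauli v *ᵥ ψ = c • ψ) :
    ‖charFn (Matrix.vecMulVec ψ (star ψ)) v‖ = 1 := by
  have h1 : c * c = 1 := by
    have h2 : pauli v *ᵥ (pauli v *ᵥ ψ) = ψ := by
      rw [Matrix.mulVec_mulVec, pauli_mul_self, Matrix.one_mulVec]
    have h3 := congrArg (star ψ ⬝ᵥ ·) h2
    simpa only [h, Matrix.mulVec_smul, dotProduct_smul, hψ, smul_eq_mul, mul_one] using h3
  rw [charFn_vecMulVec, h, dotProduct_smul, hψ, smul_eq_mul, mul_one]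
  rcases mul_self_eq_one_iff.1 h1 with rfl | rfl <;> simp

/-- Equality in the Cauchy-Schwarz inequality: `|⟨ψ, w(v) ψ⟩| = 1` makes `ψ` an eigenvector. -/
theorem mulVec_eq_smul_of_norm_charFn_eq_one {n : ℕ} {ψ : Bits n → ℂ} (hψ : star ψ ⬝ᵥ ψ = 1)
    {v : PhaseSpace n} (h : ‖charFn (Matrix.vecMulVec ψ (star ψ)) v‖ = 1) :
    pauli v *ᵥ ψ = charFn (Matrix.vecMulVec ψ (star ψ)) v • ψ := by
  set z := charFn (Matrix.vecMulVec ψ (star ψ)) v with hz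
  have hzz : star z * z = 1 := by
    rw [mul_comm, Complex.star_def, Complex.mul_conj, Complex.normSq_eq_norm_sq, h]; simp
  have hstar : star (pauli v *ᵥ ψ) = star ψ ᵥ* pauli v := by
    rw [Matrix.star_mulVec, pauli_conjTranspose]
  have h1 : star ψ ⬝ᵥ pauli v *ᵥ ψ = z := by rw [hz, charFn_vecMulVec]
  have h2 : star (pauli v *ᵥ ψ) ⬝ᵥ ψ = z := by rw [hstar, ← Matrix.dotProduct_mulVec, h1]
  have h3 : star (pauli v *ᵥ ψ) ⬝ᵥ pauli v *ᵥ ψ = 1 := by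
    rw [hstar, Matrix.dotProduct_mulVec, Matrix.vecMul_vecMul, pauli_mul_self, Matrix.vecMul_one,
      hψ]
  have h4 : star z = z := star_charFn (Matrix.posSemidef_vecMulVec_self_star ψ).1 v
  refine sub_eq_zero.1 (dotProduct_star_self_eq_zero.1 ?_)
  rw [star_sub, star_smul, sub_dotProduct, dotProduct_sub, dotProduct_sub, h3,
    smul_dotProduct, dotProduct_smul, smul_dotProduct, dotProduct_smul, h1, h2, hψ, h4]
  rw [h4] at hzz
  simp only [smul_eq_mul, mul_one, hzz, sub_self]

/-- The characteristic function of a pure stabilizer state vanishes off its group, because the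
group already exhausts Parseval's identity. -/
theorem IsPureStabilizer.norm_charFn {n : ℕ} {ρ : Op n} (h : IsPureStabilizer ρ)
    (v : PhaseSpace n) : charFn ρ v = 0 ∨ ‖charFn ρ v‖ = 1 := by
  classical
  have hP := h.isPure.sum_norm_charFn_sq
  obtain ⟨S, ψ, hS, _, hψ, h4, rfl⟩ := h
  set ρ := Matrix.vecMulVec ψ (star ψ)
  have hone : ∀ a ∈ S, ‖charFn ρ a‖ = 1 := by
    intro a ha
    obtain ⟨c, hc⟩ := h4 a ha
    exact norm_charFn_eq_one_of_mulVec_eq_smul hψ hc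
  have hcard : ∑ v with v ∈ S, ‖charFn ρ v‖ ^ 2 = 2 ^ n := by
    rw [Finset.sum_congr rfl fun a ha => by rw [hone a (Finset.mem_filter.1 ha).2, one_pow],
      Finset.sum_const, nsmul_eq_mul, mul_one, ← Fintype.card_subtype, ← Nat.card_eq_fintype_card]
    exact_mod_cast hS
  rw [← Finset.sum_filter_add_sum_filter_not _ (fun v => v ∈ S), hcard, add_eq_left] at hP
  by_cases hv : v ∈ S
  · exact Or.inr (hone v hv)
  · have := (Finset.sum_eq_zero_iff_of_nonneg fun v _ => by positivity).1 hP v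
      (Finset.mem_filter.2 ⟨Finset.mem_univ _, hv⟩)
    exact Or.inl (norm_eq_zero.1 (pow_eq_zero_iff (by norm_num) |>.1 this))

/-- A pure state whose characteristic function has only the moduli `0` and `1` is a stabilizer
state: by Parseval's identity the points of modulus `1` form a group of order `2ⁿ`. -/
theorem IsPure.isPureStabilizer_of_norm_charFn {n : ℕ} {ρ : Op n} (h : IsPure ρ)
    (h01 : ∀ v, ‖charFn ρ v‖ = 0 ∨ ‖charFn ρ v‖ = 1) : IsPureStabilizer ρ := by
  classical
  have hP := h.sum_norm_charFn_sq
  obtain ⟨ψ, hψ, rfl⟩ := h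
  have hψ0 : ψ ≠ 0 := by
    rintro rfl
    simp at hψ
  let S : AddSubgroup (PhaseSpace n) :=
    { carrier := {v | ∃ c : ℂ, pauli v *ᵥ ψ = c • ψ}
      zero_mem' := ⟨1, by rw [pauli_zero, Matrix.one_mulVec, one_smul]⟩
      add_mem' := by
        rintro a b ⟨c, hc⟩ ⟨d, hd⟩
        refine ⟨(phase a * phase b * (phase (a + b))⁻¹ * chi b.1 a.2)⁻¹ * (d * c), ?_⟩
        have h0 : phase a * phase b * (phase (a + b))⁻¹ * chi b.1 a.2 ≠ 0 := by
          have : chi b.1 a.2 ≠ 0 := by rw [← norm_ne_zero_iff, norm_chi]; exact one_ne_zero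
          simp [phase_ne_zero, this]
        rw [mul_smul, eq_inv_smul_iff₀ h0, ← Matrix.smul_mulVec, ← pauli_mul,
          ← Matrix.mulVec_mulVec, hd, Matrix.mulVec_smul, hc, smul_smul]
      neg_mem' := by
        intro a ha
        rwa [phaseSpace_neg] }
  have hS : ∀ v, v ∈ S ↔ ‖charFn (Matrix.vecMulVec ψ (star ψ)) v‖ = 1 := fun v =>
    ⟨fun ⟨_, hc⟩ => norm_charFn_eq_one_of_mulVec_eq_smul hψ hc,
      fun hv => ⟨_, mulVec_eq_smul_of_norm_charFn_eq_one hψ hv⟩⟩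
  refine ⟨S, ψ, ?_, ?_, hψ, fun a ha => ha, rfl⟩
  · have h1 : ∀ v, ‖charFn (Matrix.vecMulVec ψ (star ψ)) v‖ ^ 2 = if v ∈ S then 1 else 0 := by
      intro v
      rw [hS]
      rcases h01 v with h | h <;> simp [h]
    simp only [h1] at hP
    rw [Finset.sum_boole, ← Fintype.card_subtype, ← Nat.card_eq_fintype_card] at hP
    exact_mod_cast hP
  · rintro a ha b hb
    have h1 : comSign a b = 1 ∨ comSign a b = -1 := mul_self_eq_one_iff.1 (comSign_mul_self a b)
    rcases h1 with h1 | h1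
    · rw [pauli_mul_comm, h1, one_smul]
    · -- anticommuting operators have no common eigenvector with nonzero eigenvalues
      exfalso
      have ha' := mulVec_eq_smul_of_norm_charFn_eq_one hψ ((hS a).1 ha)
      have hb' := mulVec_eq_smul_of_norm_charFn_eq_one hψ ((hS b).1 hb)
      have h2 := congrArg (· *ᵥ ψ) (pauli_mul_comm a b)
      simp only [Matrix.smul_mulVec, ← Matrix.mulVec_mulVec, ha', hb', Matrix.mulVec_smul, h1,
        smul_smul] at h2
      have h3 := smul_left_injective ℂ hψ0 h2
      have h4 : charFn (Matrix.vecMulVec ψ (star ψ)) a *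
          charFn (Matrix.vecMulVec ψ (star ψ)) b = 0 := by
        linear_combination (1 / 2) * h3
      have h4 := congrArg norm h4
      rw [norm_mul, (hS a).1 ha, (hS b).1 hb] at h4
      simp at h4

theorem isPure_conv3_iff {n : ℕ} {ψ : Op n} (hψ : IsPure ψ) :
    IsPure (conv3 fun _ => ψ) ↔ IsStabilizer ψ := by
  constructor
  · intro h
    refine subset_convexHull ℝ _ (hψ.isPureStabilizer_of_norm_charFn fun v => ?_)
    have h1 := h.sum_norm_charFn_sq
    rw [← hψ.sum_norm_charFn_sq, eq_comm, ← sub_eq_zero, ← Finset.sum_sub_distrib] at h1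
    have h2 : ∀ v, ‖charFn ψ v‖ ^ 2 - ‖charFn (conv3 fun _ => ψ) v‖ ^ 2 =
        ‖charFn ψ v‖ ^ 2 * (1 - ‖charFn ψ v‖ ^ 4) := by
      intro v
      rw [charFn_conv3, norm_mul, norm_chi, Finset.prod_const, norm_pow, Finset.card_univ,
        Fintype.card_fin]
      ring
    simp only [h2] at h1
    have h3 := (Finset.sum_eq_zero_iff_of_nonneg fun v _ => mul_nonneg (by positivity)
      (sub_nonneg.2 (pow_le_one₀ (norm_nonneg _) (norm_charFn_le_one hψ.isState v)))).1 h1 v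
      (Finset.mem_univ _)
    rcases mul_eq_zero.1 h3 with h4 | h4
    · exact Or.inl (pow_eq_zero_iff (by norm_num) |>.1 h4)
    · exact Or.inr ((pow_eq_one_iff_of_nonneg (norm_nonneg _) (by norm_num)).1
        (sub_eq_zero.1 h4).symm)
  · intro h
    have h1 := h.isPureStabilizer hψ
    -- here `Ξ³ = Ξ`, so that the convolution is the transpose
    have h2 : (conv3 fun _ => ψ) = ψᵀ := by
      refine charFn_injective fun v => ?_
      rw [charFn_conv3, charFn_transpose, Finset.prod_const, Finset.card_univ, Fintype.card_fin]
      rcases h1.norm_charFn v with h3 | h3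
      · simp [h3]
      · rw [pow_succ, charFn_sq_of_norm_eq_one hψ.isState.isHermitian h3, one_mul]
    rw [h2]
    exact hψ.transpose

/-! ### Clifford unitaries -/

theorem pauli_ne_smul {n : ℕ} {a b : PhaseSpace n} (hab : a ≠ b) (c : ℂ) (hc : c ≠ 0) :
    pauli a ≠ c • pauli b := by
  intro h
  have h1 := congrArg (charFn · b) h
  simp only [charFn_smul, charFn_pauli, if_neg hab.symm, if_true] at h1
  simp [hc] at h1

/-- A Clifford unitary acts on phase space by a bijection, with signs. -/
theorem IsClifford.exists_equiv {n : ℕ} {U : Op n} (hU : IsClifford U) :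
    ∃ (g : PhaseSpace n ≃ PhaseSpace n) (c : PhaseSpace n → ℂ), (∀ v, c v * c v = 1) ∧
      ∀ v, U * pauli v * Uᴴ = c v • pauli (g v) := by
  obtain ⟨hU1, hU2⟩ := hU
  choose g c hc hg using hU2
  have hUU : Uᴴ * U = 1 := Matrix.mem_unitaryGroup_iff'.1 hU1
  have hcc : ∀ v, c v * c v = 1 := by
    intro v
    -- squaring the conjugation relation gives `1` on the left
    have h : (U * pauli v * Uᴴ) * (U * pauli v * Uᴴ) = 1 := by
      calc _ = U * (pauli v * (Uᴴ * U) * pauli v) * Uᴴ := by simp only [Matrix.mul_assoc]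
        _ = 1 := by
          rw [hUU, Matrix.mul_one, pauli_mul_self, Matrix.mul_one]
          exact Matrix.mem_unitaryGroup_iff.1 hU1
    rw [hg, Matrix.smul_mul, Matrix.mul_smul, pauli_mul_self, smul_smul] at h
    have h1 := congrFun (congrFun h 0) 0
    simpa using h1
  have hinj : Function.Injective g := by
    intro a b hab
    by_contra hne
    have hcancel : ∀ v, Uᴴ * (U * pauli v * Uᴴ) * U = pauli v := by
      intro v
      calc _ = (Uᴴ * U) * pauli v * (Uᴴ * U) := by simp only [Matrix.mul_assoc]
        _ = pauli v := by rw [hUU, Matrix.one_mul, Matrix.mul_one]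
    have hc0 : ∀ v, c v ≠ 0 := fun v h0 => by simpa [h0] using hc v
    refine pauli_ne_smul hne (c a * c b) (mul_ne_zero (hc0 a) (hc0 b)) ?_
    rw [← hcancel a, ← hcancel b, hg, hg, hab, Matrix.mul_smul, Matrix.smul_mul, Matrix.mul_smul,
      Matrix.smul_mul, smul_smul, mul_assoc (c a), hcc, mul_one]
  exact ⟨Equiv.ofBijective g (Finite.injective_iff_bijective.1 hinj), c, hcc, hg⟩

theorem charFn_unitary_conj {n : ℕ} {U : Op n} (hU : U ∈ Matrix.unitaryGroup (Bits n) ℂ)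
    {v w : PhaseSpace n} {c : ℂ} (hc : c * c = 1) (h : U * pauli v * Uᴴ = c • pauli w) (A : Op n) :
    charFn (U * A * Uᴴ) w = c * charFn A v := by
  have hUU : Uᴴ * U = 1 := Matrix.mem_unitaryGroup_iff'.1 hU
  have h1 : pauli w = c • (U * pauli v * Uᴴ) := by rw [h, smul_smul, hc, one_smul]
  rw [charFn_eq, charFn_eq, h1, Matrix.mul_smul, Matrix.trace_smul, smul_eq_mul]
  congr 1
  calc (U * A * Uᴴ * (U * pauli v * Uᴴ)).trace
      = (U * (A * (Uᴴ * U) * pauli v * Uᴴ)).trace := by simp only [Matrix.mul_assoc]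
    _ = (A * pauli v * (Uᴴ * U)).trace := by
        rw [Matrix.trace_mul_comm, hUU, Matrix.mul_one, Matrix.mul_one, Matrix.mul_assoc, hUU,
          Matrix.mul_one]
    _ = (A * pauli v).trace := by rw [hUU, Matrix.mul_one]

/-- The convolution turns conjugation by a Clifford unitary `U` into conjugation by the entrywise
complex conjugate of `U`. -/
theorem exists_isClifford_conv3 {n : ℕ} {U : Op n} (hU : IsClifford U) :
    ∃ U₁ : Op n, IsClifford U₁ ∧
      ∀ ρ : Fin 3 → Op n, U₁ * conv3 ρ * U₁ᴴ = conv3 fun i => U * ρ i * Uᴴ := by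
  obtain ⟨g, c, hc, hg⟩ := hU.exists_equiv
  have hconj : ∀ A : Op n, Uᴴᵀ * A * Uᴴᵀᴴ = (U * Aᵀ * Uᴴ)ᵀ := by
    intro A
    rw [Matrix.transpose_mul, Matrix.transpose_mul, Matrix.transpose_transpose, Matrix.mul_assoc]
    congr 2
    ext i j
    simp
  have hU₁ : Uᴴᵀ ∈ Matrix.unitaryGroup (Bits n) ℂ := by
    rw [Matrix.mem_unitaryGroup_iff, Matrix.star_eq_conjTranspose]
    have h := hconj 1
    rw [Matrix.mul_one, Matrix.transpose_one, Matrix.mul_one] at h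
    rw [h, ← Matrix.star_eq_conjTranspose, Matrix.mem_unitaryGroup_iff.1 hU.1,
      Matrix.transpose_one]
  have hg₁ : ∀ v, Uᴴᵀ * pauli v * Uᴴᵀᴴ =
      (chi v.1 v.2 * c v * chi (g v).1 (g v).2) • pauli (g v) := by
    intro v
    rw [hconj, pauli_transpose, Matrix.mul_smul, Matrix.smul_mul, hg, Matrix.transpose_smul,
      Matrix.transpose_smul, pauli_transpose, smul_smul, smul_smul, mul_assoc]
  have hnorm : ∀ v, ‖c v‖ = 1 := by
    intro v
    rcases mul_self_eq_one_iff.1 (hc v) with h | h <;> simp [h]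
  refine ⟨Uᴴᵀ, ⟨hU₁, fun v => ⟨g v, _, ?_, hg₁ v⟩⟩, fun ρ => charFn_injective fun w => ?_⟩
  · rw [norm_mul, norm_mul, norm_chi, norm_chi, hnorm, one_mul, one_mul]
  · obtain ⟨v, rfl⟩ := g.surjective w
    have h1 := chi_mul_self v.1 v.2
    have h2 := chi_mul_self (g v).1 (g v).2
    rw [charFn_unitary_conj hU₁ _ (hg₁ v), charFn_conv3, charFn_conv3]
    · simp only [charFn_unitary_conj hU.1 (hc v) (hg v), Fin.prod_univ_three]
      linear_combination (c v * chi (g v).1 (g v).2 * charFn (ρ 0) v * charFn (ρ 1) v *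
        charFn (ρ 2) v) * (h1 - hc v)
    · linear_combination (chi (g v).1 (g v).2 * chi (g v).1 (g v).2 * c v * c v) * h1 +
        (chi (g v).1 (g v).2 * chi (g v).1 (g v).2) * hc v + h2

/-! ### Mean states and the central limit theorem -/

theorem meanState_conv3 {n : ℕ} {ρ : Fin 3 → Op n} (h : ∀ i, IsState (ρ i)) :
    meanState (conv3 ρ) = conv3 fun i => meanState (ρ i) := by
  refine charFn_injective fun v => ?_
  rw [charFn_conv3, charFn_meanState]
  simp only [charFn_meanState]
  have hn : ‖charFn (conv3 ρ) v‖ = ∏ k, ‖charFn (ρ k) v‖ := by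
    rw [charFn_conv3, norm_mul, norm_chi, one_mul, norm_prod]
  by_cases h1 : ∀ k, ‖charFn (ρ k) v‖ = 1
  · have h2 : ‖charFn (conv3 ρ) v‖ = 1 := by rw [hn]; simp [h1]
    rw [meanCharFn, if_pos h2, charFn_conv3]
    simp only [meanCharFn, h1, if_true]
  · obtain ⟨k, hk⟩ := not_forall.1 h1
    have h2 : ‖charFn (conv3 ρ) v‖ ≠ 1 := by
      rw [hn]
      refine ne_of_lt (lt_of_le_of_lt ?_ (lt_of_le_of_ne (norm_charFn_le_one (h k) v) hk))
      rw [← Finset.mul_prod_erase _ _ (Finset.mem_univ k)]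
      exact mul_le_of_le_one_right (norm_nonneg _) (Finset.prod_le_one
        (fun _ _ => norm_nonneg _) fun i _ => norm_charFn_le_one (h i) v)
    rw [meanCharFn, if_neg h2, Finset.prod_eq_zero (Finset.mem_univ k) (by
      rw [meanCharFn, if_neg hk]), mul_zero]

theorem meanCharFn_transpose {n : ℕ} (ρ : Op n) (v : PhaseSpace n) :
    meanCharFn ρᵀ v = chi v.1 v.2 * meanCharFn ρ v := by
  simp only [meanCharFn, charFn_transpose, norm_mul, norm_chi, one_mul, mul_ite, mul_zero]

theorem meanCharFn_sharp {n : ℕ} (N : ℕ) (ρ : Op n) (v : PhaseSpace n) :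
    meanCharFn (if Even N then ρ else ρᵀ) v = chi v.1 v.2 ^ N * meanCharFn ρ v := by
  have h2 : chi v.1 v.2 ^ 2 = 1 := by rw [sq, chi_mul_self]
  split_ifs with h
  · obtain ⟨k, rfl⟩ := h
    rw [← two_mul, pow_mul, h2, one_pow, one_mul]
  · obtain ⟨k, rfl⟩ := Nat.not_even_iff_odd.1 h
    rw [meanCharFn_transpose, pow_succ, pow_mul, h2, one_pow, one_mul]

theorem norm_charFn_le_of_mem_gapSet {n : ℕ} {ρ : Op n} {v : PhaseSpace n} (h : v ∈ gapSet ρ) :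
    ‖charFn ρ v‖ ≤ 1 - magicGap ρ := by
  rw [magicGap, dif_pos ⟨v, h⟩, sub_sub_cancel]
  exact Finset.le_sup' (fun v => ‖charFn ρ v‖) h

theorem normTwo_le_of_norm_charFn_le {n : ℕ} {A B : Op n} {C : ℝ} (hC : 0 ≤ C)
    (h : ∀ v, ‖charFn A v‖ ≤ C * ‖charFn B v‖) : normTwo A ≤ C * normTwo B := by
  have hsum : ∑ v, ‖charFn A v‖ ^ 2 ≤ C ^ 2 * ∑ v, ‖charFn B v‖ ^ 2 := by
    rw [Finset.mul_sum]
    refine Finset.sum_le_sum fun v _ => ?_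
    rw [← mul_pow]
    exact pow_le_pow_left₀ (norm_nonneg _) (h v) 2
  have hC2 : C = √(C ^ 2) := (Real.sqrt_sq hC).symm
  rw [normTwo_eq, normTwo_eq, hC2, ← Real.sqrt_mul (sq_nonneg C), mul_left_comm]
  exact Real.sqrt_le_sqrt (mul_le_mul_of_nonneg_left hsum
    (inv_nonneg.2 (pow_nonneg zero_le_two n)))

theorem normTwo_convolution_sub_meanState_le {n : ℕ} {ρ : Op n} (hρ : IsState ρ) (N : ℕ) :
    normTwo (convolution N (fun _ => ρ) - meanState (if Even N then ρ else ρᵀ)) ≤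
      (1 - magicGap ρ) ^ (2 * N) * normTwo (ρ - meanState ρ) := by
  refine normTwo_le_of_norm_charFn_le (C := (1 - magicGap ρ) ^ (2 * N))
    (Even.pow_nonneg (even_two_mul N) _) fun v => ?_
  rw [charFn_sub, charFn_sub, charFn_meanState, charFn_meanState, charFn_convolution,
    meanCharFn_sharp, ← mul_sub, norm_mul, norm_pow, norm_chi, one_pow, one_mul,
    Finset.prod_const, Finset.card_univ, Fintype.card_fin]
  by_cases h1 : ‖charFn ρ v‖ = 1
  · -- here `Ξ = ±1`, and odd powers do not change it
    rw [meanCharFn, if_pos h1, pow_succ, pow_mul,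
      charFn_sq_of_norm_eq_one hρ.isHermitian h1, one_pow, one_mul, sub_self, norm_zero, mul_zero]
  · rw [meanCharFn, if_neg h1, sub_zero, sub_zero, norm_pow, pow_succ]
    by_cases h0 : charFn ρ v = 0
    · simp [h0]
    · have hv : v ∈ gapSet ρ := by
        simp [gapSet, h0, h1]
      exact mul_le_mul_of_nonneg_right (pow_le_pow_left₀ (norm_nonneg _)
        (norm_charFn_le_of_mem_gapSet hv) _) (norm_nonneg _)

end QubitConv

end

open QubitConv
theorem mainTheorem1 (n : ℕ) :
    -- (1) symmetry
    (∀ ρ : Fin 3 → Op n, (∀ i, IsState (ρ i)) → ∀ π : Equiv.Perm (Fin 3),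
      conv3 ρ = conv3 (fun i => ρ (π i))) ∧
    -- (2) convolutional stability
    (∀ ρ : Fin 3 → Op n, (∀ i, IsStabilizer (ρ i)) → IsStabilizer (conv3 ρ)) ∧
    -- (3) majorization and entropy inequality
    (∀ (ρ : Fin 3 → Op n) (hρ : ∀ i, IsState (ρ i)),
      (∀ j, Majorized (conv3_isHermitian hρ).eigenvalues (hρ j).isHermitian.eigenvalues) ∧
      (∀ (α : ℝ≥0∞) (j : Fin 3), renyiEntropy α (ρ j) (hρ j).isHermitian ≤
        renyiEntropy α (conv3 ρ) (conv3_isHermitian hρ))) ∧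
    -- (4) purity invariance of stabilizer states
    (∀ ψ : Op n, IsPure ψ → (IsPure (conv3 fun _ => ψ) ↔ IsStabilizer ψ)) ∧
    -- (5) commutativity with Clifford unitaries
    (∀ U : Op n, IsClifford U → ∃ U₁ : Op n, IsClifford U₁ ∧
      ∀ ρ : Fin 3 → Op n, (∀ i, IsState (ρ i)) →
        U₁ * conv3 ρ * U₁ᴴ = conv3 (fun i => U * ρ i * Uᴴ)) ∧
    -- (6) mean state property
    (∀ ρ : Fin 3 → Op n, (∀ i, IsState (ρ i)) →
      meanState (conv3 ρ) = conv3 (fun i => meanState (ρ i))) ∧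
    -- (7) quantum central limit theorem, with `K = 2N + 1`
    (∀ (ρ : Op n) (N : ℕ), IsState ρ →
      normTwo (convolution N (fun _ => ρ) - meanState (if Even N then ρ else ρᵀ)) ≤
        (1 - magicGap ρ) ^ (2 * N) * normTwo (ρ - meanState ρ)) := by
  refine ⟨fun ρ _ π => conv3_perm ρ π, fun ρ h => isStabilizer_conv3 h, fun ρ hρ => ⟨fun j => ?_,
    fun α j => ?_⟩, fun ψ hψ => isPure_conv3_iff hψ, fun U hU => ?_,
    fun ρ h => meanState_conv3 h, fun ρ N h => normTwo_convolution_sub_meanState_le h N⟩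
  · obtain ⟨D, hD, h⟩ := exists_doublyStochastic_conv3 hρ j
    rw [h]
    exact ⟨mulVec_mem_stdSimplex hD (hρ j).eigenvalues_mem_stdSimplex,
      (hρ j).eigenvalues_mem_stdSimplex,
      sumLargest_mulVec_le hD (hρ j).eigenvalues_mem_stdSimplex.1⟩
  · obtain ⟨D, hD, h⟩ := exists_doublyStochastic_conv3 hρ j
    exact renyiEntropy_le_of_doublyStochastic (hρ j) _ hD h α
  · obtain ⟨U₁, hU₁, h⟩ := exists_isClifford_conv3 hU
    exact ⟨U₁, hU₁, fun ρ _ => h ρ⟩
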